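/- Let $X=(X_t)_{t\ge 0}$ be a spectrally negative Lévy process on a probability space $(\Omega,\mathcal F,\mathbb P)$: $X_0=0$, the increments are stationary and independent, and the paths are càdlàg without positive jumps; as usual, processes with a.s. nonincreasing paths are excluded. Put $\overline X_t=\sup_{s\le t}X_s$, $\underline X_t=\inf_{s\le t}X_s$ and, for $c\in\mathbb R$, $$\tau_c^+=\inf\{t\ge 0: X_t\ge c\},\qquad \tau_c^-=\inf\{t\ge 0: X_t\le c\},\qquad \inf\emptyset=\infty .$$ For $y,z\ge 0$ consider the drawdown process $D_t=(\overline X_t\vee y)-X_t$ started at $D_0=y$, the drawup process $U_t=X_t-(\underline X_t\wedge(-z))$ started at $U_0=z$, and, for $a>b>0$, the times $$\tau_D^+(a)=\inf\{t\ge0: D_t\ge a\},\qquad \tau_U^+(b)=\inf\{t\ge 0:U_t\ge b\}.$$ Let $\tau_{U,0}^+(b)=\inf\{t\ge 0: X_t-\underline X_t\ge b\}$ be the drawup time for the drawup process started at $0$. Let $r\ge 0$, write $\mathbb E[\,\cdot\,;A]=\mathbb E[\,\cdot\,\mathbf 1_A]$ and $e^{-r\infty}=0$, and define $$\nu(y,z)=\mathbb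 E\big[e^{-r\tau_D^+(a)};\ \tau_D^+(a)\le\tau_U^+(b)\big],\qquad \lambda(y,z)=\mathbb E\big[e^{-r\tau_U^+(b)};\ \tau_U^+(b)<\tau_D^+(a)\big].$$ Suppose that not both $y\ge a$ and $z\ge b$. Then $$\nu(y,z)=\mathbb E\big[e^{-r\tau^-_{y-a}};\ \tau^-_{y-a}<\tau^+_{b-z}\big]\mathbf 1_{\{y+z\ge a\}}+\mathbb E\Big[e^{-r\tau_U^+(b)};\ (\overline X_{\tau_U^+(b)}\vee y)-\underline X_{\tau_U^+(b)}\ge a,\ \underline X_{\tau_U^+(b)}\le -z,\ \overline X_{\tau_U^+(b)}\le b-z\Big]\frac{\mathbf 1_{\{y+z<a\}}}{\mathbb E\big[e^{-r\tau_{U,0}^+(b)}\big]}$$ and $$\lambda(y,z)=\mathbb E\big[e^{-r\tau^+_{b-z}};\ \tau^+_{b-z}<\tau^-_{(y-a)\vee(-z)}\big]+\mathbb E\Big[e^{-r\tau_U^+(b)};\ (\overline X_{\tau_U^+(b)}\vee y)-\underline X_{\tau_U^+(b)}<a,\ \underline X_{\tau_U^+(b)}\le -z\Big].$$ -/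

import Mathlib

open MeasureTheory ProbabilityTheory Filter Topology
open scoped NNReal

namespace DrawdownInsurance

variable {Ω : Type*} [MeasurableSpace Ω]

/-- A spectrally negative Lévy process started at `0`: independent and stationary increments,
almost surely càdlàg paths without positive jumps. As usual, processes with (almost surely)
nonincreasing paths, i.e. negatives of subordinators and the zero process, are excluded. -/
structure IsSpectrallyNegativeLevy (X : ℝ≥0 → Ω → ℝ) (P : Measure Ω) : Prop where
  measurable : ∀ t, Measurable (X t)
  zero : ∀ᵐ ω ∂P, X 0 ω = 0
  indep : HasIndepIncrements X P
  stationary : ∀ s t, IdentDistrib (fun ω => X (s + t) ω - X s ω) (X t) P P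
  rightCont : ∀ᵐ ω ∂P, ∀ t, ContinuousWithinAt (fun s => X s ω) (Set.Ici t) t
  leftLim : ∀ᵐ ω ∂P, ∀ t, 0 < t →
    ∃ l : ℝ, Tendsto (fun s => X s ω) (𝓝[<] t) (𝓝 l) ∧ X t ω ≤ l
  not_antitone : ¬ ∀ᵐ ω ∂P, Antitone (fun t => X t ω)

/-- The running supremum `sup_{s ≤ t} X_s`. -/
noncomputable def runSup (X : ℝ≥0 → Ω → ℝ) (t : ℝ≥0) (ω : Ω) : ℝ :=
  sSup ((fun s => X s ω) '' Set.Iic t)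

/-- The running infimum `inf_{s ≤ t} X_s`. -/
noncomputable def runInf (X : ℝ≥0 → Ω → ℝ) (t : ℝ≥0) (ω : Ω) : ℝ :=
  sInf ((fun s => X s ω) '' Set.Iic t)

/-- The drawdown process with historical maximum `y`. If `X` starts at `0` and `0 ≤ y`,
its starting point is `y`. -/
noncomputable def drawdown (X : ℝ≥0 → Ω → ℝ) (y : ℝ) (t : ℝ≥0) (ω : Ω) : ℝ :=
  max (runSup X t ω) y - X t ω

/-- The drawup process with historical minimum `-z`. If `X` starts at `0` and `0 ≤ z`,
its starting point is `z`. -/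
noncomputable def drawup (X : ℝ≥0 → Ω → ℝ) (z : ℝ) (t : ℝ≥0) (ω : Ω) : ℝ :=
  X t ω - min (runInf X t ω) (-z)

/-- The first time (from time `0` on) at which the process `Y` is at or above `c`;
it is `⊤` if there is no such time. -/
noncomputable def passageUp (Y : ℝ≥0 → Ω → ℝ) (c : ℝ) : Ω → WithTop ℝ≥0 :=
  hittingAfter Y (Set.Ici c) 0

/-- The first time (from time `0` on) at which the process `Y` is at or below `c`;
it is `⊤` if there is no such time. -/
noncomputable def passageDown (Y : ℝ≥0 → Ω → ℝ) (c : ℝ) : Ω → WithTop ℝ≥0 :=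
  hittingAfter Y (Set.Iic c) 0

/-- The discount factor `exp (-r τ)`, equal to `0` when `τ` is infinite. -/
noncomputable def discount (r : ℝ) : WithTop ℝ≥0 → ℝ
  | ⊤ => 0
  | (t : ℝ≥0) => Real.exp (-r * t)

/-- The discounted expectation `E[exp (-r τ); A]` of the time `τ` on the event `A`.
Only the part of `A` on which `τ` is finite matters. -/
noncomputable def discExp (P : Measure Ω) (r : ℝ) (τ : Ω → WithTop ℝ≥0) (A : Set Ω) : ℝ :=
  ∫ ω, A.indicator (fun ω => discount r (τ ω)) ω ∂P

/-- First time that the drawdown process started from `y` reaches `a`. -/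
noncomputable def tauD (X : ℝ≥0 → Ω → ℝ) (y a : ℝ) : Ω → WithTop ℝ≥0 :=
  passageUp (drawdown X y) a

/-- First time that the drawup process started from `z` reaches `b`. -/
noncomputable def tauU (X : ℝ≥0 → Ω → ℝ) (z b : ℝ) : Ω → WithTop ℝ≥0 :=
  passageUp (drawup X z) b

/-- `ν(y, z)`: discounted expectation of the drawdown time when the drawdown of size `a` does
not come after the drawup of size `b`. -/
noncomputable def nu (X : ℝ≥0 → Ω → ℝ) (P : Measure Ω) (r a b y z : ℝ) : ℝ :=
  discExp P r (tauD X y a) {ω | tauD X y a ω ≤ tauU X z b ω}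

/-- `λ(y, z)`: discounted expectation of the drawup time when the drawup of size `b` comes
before the drawdown of size `a`. -/
noncomputable def lam (X : ℝ≥0 → Ω → ℝ) (P : Measure Ω) (r a b y z : ℝ) : ℝ :=
  discExp P r (tauU X z b) {ω | tauU X z b ω < tauD X y a ω}

/-- The running supremum at the time `τ` (of relevance only where `τ` is finite). -/
noncomputable def supAt (X : ℝ≥0 → Ω → ℝ) (τ : Ω → WithTop ℝ≥0) : Ω → ℝ :=
  stoppedValue (runSup X) τ

/-- The running infimum at the time `τ` (of relevance only where `τ` is finite). -/
noncomputable def infAt (X : ℝ≥0 → Ω → ℝ) (τ : Ω → WithTop ℝ≥0) : Ω → ℝ :=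
  stoppedValue (runInf X) τ

end DrawdownInsurance

/-!
After a change on a null set, all paths are right-continuous with left limits, start at `0` and
have no positive jumps (`IsSpectrallyNegativeLevy.exists_isRegularLevy`). Most of the theorem is
then deterministic. Let `R` be the range process `(sup X ∨ y) - (inf X ∧ -z)`, the sum of drawdown
and drawup, and let `ρ = tauR X y z a` be the first time that it reaches `a`. The key observation
(`eq_runInf_of_rangeProc`) is that if `y + z < a` and the drawup has stayed below `b < a` before
`ρ`, then `X` is at a new running minimum at `ρ`; hence the drawup is `0` and the drawdown is
`R ≥ a` there. So the drawdown event is `{ρ < τ_U}`, with `τ_D = ρ` on it, and it is also the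
event in the numerator of the formula for `nu`. For `a ≤ y + z`, the drawdown event is a two-sided
exit event of `X`, because the historical extrema are not updated before the exit. The formula for
`lam` follows by splitting `{τ_U < τ_D}` according to whether `X` has reached `-z`.

The probabilistic content of the formula for `nu` is the strong Markov property at `ρ`
(`IsRegularLevy.map_restart_stoppingTime`): on `{ρ < τ_U}` the drawup process starts afresh from
`0` at `ρ`, so the discounted drawup time factorizes (`IsRegularLevy.discExp_tauU_eq_mul`). It is
proved for the natural filtration, by discretising the stopping time from above. The denominator is
positive since the paths are not almost surely nonincreasing (`IsRegularLevy.discExp_tauU_pos`).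

One point of measurability needs care: the passage times upwards over a level are not Borel
functionals of the path, as a path may jump down at the very moment at which it approaches the
level. By quasi-left-continuity this almost surely does not happen
(`IsRegularLevy.passageUp_ae_eq`), so these times agree almost surely with the passage times of the
running supremum, which are stopping times.
-/

namespace DrawdownInsurance

section Paths

/-! ### Regular paths -/

variable {Ω : Type*}

/-- Right-continuous paths with left limits and without positive jumps. -/
structure IsRegularPath (x : ℝ≥0 → ℝ) : Prop where
  rightCont : ∀ t, ContinuousWithinAt x (Set.Ici t) t
  leftLim : ∀ t, 0 < t → ∃ l : ℝ, Tendsto x (𝓝[<] t) (𝓝 l) ∧ x t ≤ l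

namespace IsRegularPath

variable {x : ℝ≥0 → ℝ}

lemma eventually_gt (hx : IsRegularPath x) {t : ℝ≥0} {c : ℝ} (hc : c < x t) :
    ∀ᶠ s in 𝓝 t, c < x s := by
  rw [← nhdsLT_sup_nhdsGE, eventually_sup]
  refine ⟨?_, (hx.rightCont t).eventually (lt_mem_nhds hc)⟩
  rcases eq_or_ne t 0 with rfl | ht
  · simp
  · obtain ⟨l, hl, hle⟩ := hx.leftLim t (pos_iff_ne_zero.2 ht)
    exact hl.eventually (lt_mem_nhds (hc.trans_le hle))

lemma lowerSemicontinuous (hx : IsRegularPath x) : LowerSemicontinuous x :=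
  fun _ _ hc => hx.eventually_gt hc

lemma exists_eventually_le (hx : IsRegularPath x) (t : ℝ≥0) :
    ∃ c, ∀ᶠ s in 𝓝 t, x s ≤ c := by
  obtain ⟨c, hc⟩ : ∃ c, ∀ᶠ s in 𝓝[<] t, x s ≤ c := by
    rcases eq_or_ne t 0 with rfl | ht
    · simp
    · obtain ⟨l, hl, -⟩ := hx.leftLim t (pos_iff_ne_zero.2 ht)
      exact ⟨l + 1, (hl.eventually (gt_mem_nhds (lt_add_one l))).mono fun _ h => h.le⟩
  have h2 := (hx.rightCont t).eventually (gt_mem_nhds (lt_add_one (x t)))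
  refine ⟨max c (x t + 1), ?_⟩
  rw [← nhdsLT_sup_nhdsGE, eventually_sup]
  exact ⟨hc.mono fun _ h => h.trans (le_max_left _ _),
    h2.mono fun _ h => h.le.trans (le_max_right _ _)⟩

lemma bddAbove (hx : IsRegularPath x) (t : ℝ≥0) : BddAbove (x '' Set.Iic t) := by
  have hc : IsCompact (Set.Iic t) := by rw [← Set.Icc_bot]; exact isCompact_Icc
  refine hc.induction_on (p := fun s => BddAbove (x '' s)) (by simp)
    (fun s u hsu hu => hu.mono (Set.image_mono hsu))
    (fun s u hs hu => by rw [Set.image_union]; exact hs.union hu) fun s _ => ?_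
  obtain ⟨c, h⟩ := hx.exists_eventually_le s
  exact ⟨_, nhdsWithin_le_nhds h, c, by rintro _ ⟨u, hu, rfl⟩; exact hu⟩

lemma exists_isMinOn (hx : IsRegularPath x) (t : ℝ≥0) : ∃ s ≤ t, ∀ u ≤ t, x s ≤ x u := by
  have hc : IsCompact (Set.Iic t) := by rw [← Set.Icc_bot]; exact isCompact_Icc
  obtain ⟨s, hs, h⟩ :=
    (hx.lowerSemicontinuous.lowerSemicontinuousOn (Set.Iic t)).exists_isMinOn
      ⟨t, Set.self_mem_Iic⟩ hc
  exact ⟨s, hs, fun u hu => h hu⟩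

lemma bddBelow (hx : IsRegularPath x) (t : ℝ≥0) : BddBelow (x '' Set.Iic t) := by
  obtain ⟨s, -, h⟩ := hx.exists_isMinOn t
  exact ⟨x s, by rintro _ ⟨u, hu, rfl⟩; exact h u hu⟩

/-- Without positive jumps, a level that is not exceeded before a time is not exceeded at it. -/
lemma le_of_forall_lt (hx : IsRegularPath x) {t : ℝ≥0} (ht : 0 < t) {c : ℝ}
    (h : ∀ s < t, x s ≤ c) : x t ≤ c := by
  obtain ⟨l, hl, hle⟩ := hx.leftLim t ht
  have : (𝓝[<] t).NeBot := nhdsLT_neBot_of_exists_lt ⟨0, ht⟩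
  exact hle.trans (le_of_tendsto hl (eventually_nhdsWithin_of_forall fun s hs => h s hs))

end IsRegularPath

lemma exists_nnrat_btwn {u v : ℝ≥0} (h : u < v) : ∃ r : ℚ≥0, u < r ∧ (r : ℝ≥0) < v := by
  obtain ⟨r, hr1, hr2⟩ := exists_rat_btwn (show (u : ℝ) < v from h)
  lift r to ℚ≥0 using by exact_mod_cast (u.2.trans_lt hr1).le
  refine ⟨r, ?_, ?_⟩ <;> rw [← NNReal.coe_lt_coe]
  · exact_mod_cast hr1
  · exact_mod_cast hr2

/-- A strict lower bound of a right-continuous function at `v` also holds at a rational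
point of `[v, q)`. -/
lemma exists_rat_lt_of_lt {f : ℝ≥0 → ℝ} {v : ℝ≥0}
    (hf : ContinuousWithinAt f (Set.Ici v) v) {c : ℝ} (hc : c < f v) {q : ℝ≥0} (hq : v < q) :
    ∃ r : ℚ≥0, v ≤ r ∧ r < q ∧ c < f r := by
  obtain ⟨u, hu, hsub⟩ := (mem_nhdsGE_iff_exists_Ico_subset' hq).1
    (hf.eventually (lt_mem_nhds hc))
  obtain ⟨r, h1, h2⟩ := exists_nnrat_btwn (lt_min hu hq)
  exact ⟨r, h1.le, h2.trans_le (min_le_right _ _), hsub ⟨h1.le, h2.trans_le (min_le_left _ _)⟩⟩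

/-- A strict lower bound of a right-continuous function at `v` also holds at a rational
point of `[v, q]`. -/
lemma exists_rat_le_of_lt {f : ℝ≥0 → ℝ} {v : ℝ≥0}
    (hf : ContinuousWithinAt f (Set.Ici v) v) {c : ℝ} (hc : c < f v) {q : ℚ≥0} (hq : v ≤ q) :
    ∃ r : ℚ≥0, v ≤ r ∧ r ≤ q ∧ c < f r := by
  rcases hq.eq_or_lt with rfl | hq
  · exact ⟨q, le_rfl, le_rfl, hc⟩
  · obtain ⟨r, h1, h2, h3⟩ := exists_rat_lt_of_lt hf hc hq
    exact ⟨r, h1, by exact_mod_cast h2.le, h3⟩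

variable {X Y : ℝ≥0 → Ω → ℝ} {ω : Ω} {s t : ℝ≥0} {c : ℝ}

/-! ### Running extrema -/

lemma le_runSup (h : BddAbove ((fun u => X u ω) '' Set.Iic t)) (hst : s ≤ t) :
    X s ω ≤ runSup X t ω := le_csSup h ⟨s, hst, rfl⟩

lemma runSup_le (h : ∀ s ≤ t, X s ω ≤ c) : runSup X t ω ≤ c :=
  csSup_le ⟨_, t, Set.self_mem_Iic, rfl⟩ (by rintro _ ⟨s, hs, rfl⟩; exact h s hs)

lemma lt_runSup_iff (h : BddAbove ((fun u => X u ω) '' Set.Iic t)) :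
    c < runSup X t ω ↔ ∃ s ≤ t, c < X s ω := by
  rw [runSup, lt_csSup_iff h ⟨_, t, Set.self_mem_Iic, rfl⟩]
  simp

lemma runSup_mono (h : ∀ t, BddAbove ((fun u => X u ω) '' Set.Iic t)) :
    Monotone fun t => runSup X t ω :=
  fun _ v huv => runSup_le fun _ hs => le_runSup (h v) (hs.trans huv)

lemma runInf_eq_neg (X : ℝ≥0 → Ω → ℝ) (t : ℝ≥0) (ω : Ω) :
    runInf X t ω = - runSup (fun t ω => - X t ω) t ω := by
  rw [runInf, runSup, Real.sInf_def, ← Set.image_neg_eq_neg, Set.image_image]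

lemma runSup_rightCont (hb : ∀ t, BddAbove ((fun u => X u ω) '' Set.Iic t))
    (hc : ∀ t, ContinuousWithinAt (fun u => X u ω) (Set.Ici t) t) (t : ℝ≥0) :
    ContinuousWithinAt (fun u => runSup X u ω) (Set.Ici t) t := by
  refine tendsto_order.2 ⟨fun c hcl => ?_, fun c hcl => ?_⟩
  · exact eventually_nhdsWithin_of_forall fun s hs => hcl.trans_le (runSup_mono hb hs)
  · obtain ⟨d, hd1, hd2⟩ := exists_between hcl
    have hd : X t ω < d := (le_runSup (hb t) le_rfl).trans_lt hd1
    obtain ⟨u, hu, hsub⟩ := mem_nhdsGE_iff_exists_Ico_subset.1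
      ((hc t).eventually (gt_mem_nhds hd))
    filter_upwards [Ico_mem_nhdsGE hu] with s hs
    refine (runSup_le fun v hv => ?_).trans_lt hd2
    rcases le_total v t with h | h
    · exact (le_runSup (hb t) h).trans hd1.le
    · exact (hsub ⟨h, hv.trans_lt hs.2⟩ : X v ω < d).le

section Regular

variable (hX : IsRegularPath fun t => X t ω)
include hX

lemma runInf_le (hst : s ≤ t) : runInf X t ω ≤ X s ω := csInf_le (hX.bddBelow t) ⟨s, hst, rfl⟩

lemma exists_eq_runInf (t : ℝ≥0) : ∃ s ≤ t, X s ω = runInf X t ω := by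
  obtain ⟨s, hs, h⟩ := hX.exists_isMinOn t
  exact ⟨s, hs, le_antisymm (le_csInf ⟨_, t, Set.self_mem_Iic, rfl⟩
    (by rintro _ ⟨u, hu, rfl⟩; exact h u hu))
    (runInf_le hX hs)⟩

lemma runInf_anti : Antitone fun t => runInf X t ω := fun u v huv => by
  obtain ⟨s, hs, h⟩ := exists_eq_runInf hX u
  exact (runInf_le hX (hs.trans huv)).trans h.le

lemma runInf_rightCont (t : ℝ≥0) :
    ContinuousWithinAt (fun u => runInf X u ω) (Set.Ici t) t := by
  simp only [runInf_eq_neg]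
  refine (runSup_rightCont (fun t => ?_) (fun t => (hX.rightCont t).neg) t).neg
  obtain ⟨m, hm⟩ := hX.bddBelow t
  exact ⟨-m, by rintro _ ⟨u, hu, rfl⟩; exact neg_le_neg (hm ⟨u, hu, rfl⟩)⟩

/-- The left limit of the drawup process, in terms of those of the process and of its
running infimum. -/
lemma drawup_leftLim {z : ℝ} (ht : 0 < t) {l : ℝ}
    (hl : Tendsto (fun s => X s ω) (𝓝[<] t) (𝓝 l)) (hle : X t ω ≤ l) :
    ∃ m, Tendsto (fun s => drawup X z s ω) (𝓝[<] t) (𝓝 m) ∧ drawup X z t ω ≤ m ∧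
      m - drawup X z t ω ≤ l - X t ω := by
  have hne : (𝓝[<] t).NeBot := nhdsLT_neBot_of_exists_lt ⟨0, ht⟩
  set i := sInf ((fun s => runInf X s ω) '' Set.Iio t)
  have hi : Tendsto (fun s => runInf X s ω) (𝓝[<] t) (𝓝 i) := (runInf_anti hX).tendsto_nhdsLT t
  have hi1 : ∀ s < t, i ≤ runInf X s ω := fun s hs =>
    le_of_tendsto hi (by
      filter_upwards [Ioo_mem_nhdsLT hs] with u hu using runInf_anti hX hu.1.le)
  have hi2 : runInf X t ω ≤ i := ge_of_tendsto hi
    (eventually_nhdsWithin_of_forall fun s hs => runInf_anti hX (le_of_lt hs))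
  have hi3 : i ≤ l := le_of_tendsto_of_tendsto' hi hl fun s => runInf_le hX le_rfl
  have hi4 : min i (X t ω) ≤ runInf X t ω := by
    obtain ⟨s, hs, h⟩ := exists_eq_runInf hX t
    rw [← h]
    rcases hs.eq_or_lt with rfl | hs
    · exact min_le_right _ _
    · exact (min_le_left _ _).trans ((hi1 s hs).trans (runInf_le hX le_rfl))
  refine ⟨l - min i (-z), hl.sub (hi.min tendsto_const_nhds), ?_, ?_⟩ <;> unfold drawup <;> grind

lemma drawup_regular (z : ℝ) : IsRegularPath fun t => drawup X z t ω where
  rightCont t := (hX.rightCont t).sub ((runInf_rightCont hX t).min continuousWithinAt_const)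
  leftLim t ht := by
    obtain ⟨l, hl, hle⟩ := hX.leftLim t ht
    obtain ⟨m, hm, hm1, -⟩ := drawup_leftLim hX (z := z) ht hl hle
    exact ⟨m, hm, hm1⟩

lemma drawdown_rightCont (y : ℝ) (t : ℝ≥0) :
    ContinuousWithinAt (fun t => drawdown X y t ω) (Set.Ici t) t :=
  ((runSup_rightCont hX.bddAbove hX.rightCont t).max continuousWithinAt_const).sub
    (hX.rightCont t)

end Regular

/-! ### First passage times of right-continuous paths -/

lemma hittingAfter_zero_le_iff {S : Set ℝ} (hS : IsClosed S)
    (hY : ∀ t, ContinuousWithinAt (fun u => Y u ω) (Set.Ici t) t) :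
    hittingAfter Y S 0 ω ≤ t ↔ ∃ s ≤ t, Y s ω ∈ S := by
  constructor
  · intro h
    by_contra! hcon
    set A := {i : ℝ≥0 | 0 ≤ i ∧ Y i ω ∈ S}
    have hA : ∃ j, 0 ≤ j ∧ Y j ω ∈ S := by
      by_contra hn
      rw [hittingAfter, if_neg hn] at h
      exact WithTop.coe_ne_top (top_le_iff.1 h)
    rw [hittingAfter, if_pos hA] at h
    have hle : sInf A ≤ t := by exact_mod_cast h
    have hne : A.Nonempty := hA
    have hmem : Y (sInf A) ω ∉ S := hcon _ hle
    obtain ⟨u, hu, hsub⟩ := mem_nhdsGE_iff_exists_Ico_subset.1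
      ((hY (sInf A)).eventually (hS.isOpen_compl.mem_nhds hmem))
    obtain ⟨v, hv, hvu⟩ := exists_lt_of_csInf_lt hne hu
    exact hsub ⟨csInf_le (OrderBot.bddBelow _) hv, hvu⟩ hv.2
  · rintro ⟨s, hs, hsY⟩
    exact (hittingAfter_le_of_mem zero_le hsY).trans (by exact_mod_cast hs)

section Passage

variable (hY : ∀ t, ContinuousWithinAt (fun u => Y u ω) (Set.Ici t) t)
include hY

lemma passageUp_le_iff : passageUp Y c ω ≤ t ↔ ∃ s ≤ t, c ≤ Y s ω :=
  hittingAfter_zero_le_iff isClosed_Ici hY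

lemma passageDown_le_iff : passageDown Y c ω ≤ t ↔ ∃ s ≤ t, Y s ω ≤ c :=
  hittingAfter_zero_le_iff isClosed_Iic hY

lemma lt_passageUp_iff : t < passageUp Y c ω ↔ ∀ s ≤ t, Y s ω < c := by
  rw [← not_le, passageUp_le_iff hY]; push Not; rfl

lemma lt_passageDown_iff : t < passageDown Y c ω ↔ ∀ s ≤ t, c < Y s ω := by
  rw [← not_le, passageDown_le_iff hY]; push Not; rfl

lemma passageUp_eq_iff : passageUp Y c ω = t ↔ c ≤ Y t ω ∧ ∀ s < t, Y s ω < c := by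
  constructor
  · intro h
    have h2 : ∀ s < t, Y s ω < c := fun s hs =>
      (lt_passageUp_iff hY).1 (h ▸ (by exact_mod_cast hs)) s le_rfl
    obtain ⟨s, hs, hsc⟩ := (passageUp_le_iff hY).1 h.le
    rcases hs.eq_or_lt with rfl | hs
    · exact ⟨hsc, h2⟩
    · exact absurd hsc (h2 s hs).not_ge
  · rintro ⟨h1, h2⟩
    refine le_antisymm ((passageUp_le_iff hY).2 ⟨t, le_rfl, h1⟩) (not_lt.1 fun h => ?_)
    obtain ⟨u, hu⟩ := WithTop.ne_top_iff_exists.1 h.ne_top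
    obtain ⟨s, hs, hsc⟩ := (passageUp_le_iff hY).1 hu.symm.le
    rw [← hu] at h
    exact (h2 s (hs.trans_lt (by exact_mod_cast h))).not_ge hsc

lemma passageDown_eq_iff : passageDown Y c ω = t ↔ Y t ω ≤ c ∧ ∀ s < t, c < Y s ω := by
  constructor
  · intro h
    have h2 : ∀ s < t, c < Y s ω := fun s hs =>
      (lt_passageDown_iff hY).1 (h ▸ (by exact_mod_cast hs)) s le_rfl
    obtain ⟨s, hs, hsc⟩ := (passageDown_le_iff hY).1 h.le
    rcases hs.eq_or_lt with rfl | hs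
    · exact ⟨hsc, h2⟩
    · exact absurd hsc (h2 s hs).not_ge
  · rintro ⟨h1, h2⟩
    refine le_antisymm ((passageDown_le_iff hY).2 ⟨t, le_rfl, h1⟩) (not_lt.1 fun h => ?_)
    obtain ⟨u, hu⟩ := WithTop.ne_top_iff_exists.1 h.ne_top
    obtain ⟨s, hs, hsc⟩ := (passageDown_le_iff hY).1 hu.symm.le
    rw [← hu] at h
    exact (h2 s (hs.trans_lt (by exact_mod_cast h))).not_ge hsc

lemma le_passageUp_iff : t ≤ passageUp Y c ω ↔ ∀ s < t, Y s ω < c := by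
  rw [← not_lt]
  constructor
  · intro h s hs
    by_contra! hc
    exact h (((passageUp_le_iff hY).2 ⟨s, le_rfl, hc⟩).trans_lt (by exact_mod_cast hs))
  · intro h hlt
    obtain ⟨u, hu⟩ := WithTop.ne_top_iff_exists.1 hlt.ne_top
    obtain ⟨s, hs, hsc⟩ := (passageUp_le_iff hY).1 hu.symm.le
    rw [← hu] at hlt
    exact (h s (hs.trans_lt (by exact_mod_cast hlt))).not_ge hsc

end Passage

end Paths

section Pathwise

variable {Ω : Type*} {X Y : ℝ≥0 → Ω → ℝ} {ω : Ω} {s t : ℝ≥0} {a b c y z : ℝ}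

/-! ### Pathwise identities between the passage times -/

/-- The range process with historical maximum `y` and minimum `-z`: the sum of the drawdown and
the drawup processes. -/
noncomputable def rangeProc (X : ℝ≥0 → Ω → ℝ) (y z : ℝ) (t : ℝ≥0) (ω : Ω) : ℝ :=
  max (runSup X t ω) y - min (runInf X t ω) (-z)

/-- First time at which the range process with historical extrema `y` and `-z` reaches `a`. -/
noncomputable def tauR (X : ℝ≥0 → Ω → ℝ) (y z a : ℝ) : Ω → WithTop ℝ≥0 :=
  passageUp (rangeProc X y z) a

/-- The process restarted at the time `t`, seen from its position at that time. -/
def restart (X : ℝ≥0 → Ω → ℝ) (t s : ℝ≥0) (ω : Ω) : ℝ := X (t + s) ω - X t ω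

lemma runSup_zero (X : ℝ≥0 → Ω → ℝ) (ω : Ω) : runSup X 0 ω = X 0 ω := by
  simp [runSup, ← bot_eq_zero']

lemma runInf_zero (X : ℝ≥0 → Ω → ℝ) (ω : Ω) : runInf X 0 ω = X 0 ω := by
  simp [runInf, ← bot_eq_zero']

variable (hX : IsRegularPath fun t => X t ω)
include hX

lemma rangeProc_mono (y z : ℝ) : Monotone fun t => rangeProc X y z t ω := fun _ _ h =>
  sub_le_sub (max_le_max (runSup_mono hX.bddAbove h) le_rfl) (min_le_min (runInf_anti hX h) le_rfl)

lemma rangeProc_rightCont (y z : ℝ) (t : ℝ≥0) :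
    ContinuousWithinAt (fun t => rangeProc X y z t ω) (Set.Ici t) t :=
  ((runSup_rightCont hX.bddAbove hX.rightCont t).max continuousWithinAt_const).sub
    ((runInf_rightCont hX t).min continuousWithinAt_const)

lemma IsRegularPath.le_runSup (hst : s ≤ t) : X s ω ≤ runSup X t ω :=
  DrawdownInsurance.le_runSup (hX.bddAbove t) hst

lemma drawdown_le_rangeProc (y z : ℝ) (t : ℝ≥0) : drawdown X y t ω ≤ rangeProc X y z t ω := by
  have := runInf_le hX (le_refl t)
  unfold drawdown rangeProc
  grind

/-- The key pathwise fact. If the range reaches `a > b` no later than the drawup reaches `b`,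
then it does so by a new minimum: a maximum approached on the way would lie at least `b`
above the minimum. -/
lemma eq_runInf_of_rangeProc (h0 : X 0 ω = 0) (hab : b < a) (hy : 0 ≤ y) (hz : 0 ≤ z)
    (hyz : y + z < a) (hR : a ≤ rangeProc X y z t ω) (hR' : ∀ s < t, rangeProc X y z s ω < a)
    (hU : ∀ s < t, drawup X z s ω < b) : X t ω = runInf X t ω ∧ X t ω ≤ -z := by
  have ht : 0 < t := by
    rw [pos_iff_ne_zero]
    rintro rfl
    simp only [rangeProc, runSup_zero, runInf_zero, h0] at hR
    grind
  suffices h : X t ω ≤ min (runInf X t ω) (-z) by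
    exact ⟨le_antisymm (h.trans (min_le_left _ _)) (runInf_le hX le_rfl),
      h.trans (min_le_right _ _)⟩
  by_contra! hcon
  set k := min (runInf X t ω) (-z) with hk
  -- The running minimum is already equal to its value at `t` from a time `u < t` on.
  obtain ⟨u, hut, hu⟩ : ∃ u < t, ∀ s, u ≤ s → s ≤ t → min (runInf X s ω) (-z) = k := by
    rcases le_total (-z) (runInf X t ω) with h | h
    · refine ⟨0, ht, fun s _ hs => ?_⟩
      have := runInf_anti hX hs
      simp only at this
      grind
    · obtain ⟨u, hu, hu2⟩ := exists_eq_runInf hX t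
      refine ⟨u, lt_of_le_of_ne hu ?_, fun s hs hst => ?_⟩
      · rintro rfl
        grind
      · have h1 := runInf_anti hX hst
        have h2 := runInf_le hX hs
        simp only at h1
        grind
  have hb : ∀ s, u ≤ s → s < t → X s ω ≤ b + k := fun s hs hst => by
    have := hU s hst
    rw [drawup, hu s hs hst.le] at this
    linarith
  have hRu : max (runSup X u ω) y < a + k := by
    have := hR' u hut
    rw [rangeProc, hu u le_rfl hut.le] at this
    linarith
  have hlt : ∀ s < t, X s ω ≤ max (runSup X u ω) (b + k) := fun s hs => by
    rcases le_total s u with h | h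
    · exact le_max_of_le_left (hX.le_runSup h)
    · exact le_max_of_le_right (hb s h hs)
  have hM : runSup X t ω ≤ max (runSup X u ω) (b + k) := runSup_le fun s hs => by
    rcases hs.eq_or_lt with rfl | hs
    · exact hX.le_of_forall_lt ht hlt
    · exact hlt s hs
  rw [rangeProc, ← hk] at hR
  grind

/-- For `y + z < a`, the drawdown event is that the range reaches `a` before the drawup
reaches `b`. -/
lemma tauD_eq_and_le_tauU_iff (h0 : X 0 ω = 0) (hb : 0 < b) (hab : b < a) (hy : 0 ≤ y)
    (hz : 0 ≤ z) (hyz : y + z < a) :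
    (tauD X y a ω = t ∧ t ≤ tauU X z b ω) ↔ (tauR X y z a ω = t ∧ t < tauU X z b ω) := by
  have key := fun t => eq_runInf_of_rangeProc (t := t) hX h0 hab hy hz hyz
  simp only [tauD, tauU, tauR, passageUp_eq_iff (drawdown_rightCont hX y),
    passageUp_eq_iff (rangeProc_rightCont hX y z), le_passageUp_iff (drawup_regular hX z).rightCont,
    lt_passageUp_iff (drawup_regular hX z).rightCont]
  constructor
  · rintro ⟨⟨hD, hD'⟩, hU⟩
    have hR := hD.trans (drawdown_le_rangeProc hX y z t)
    have hR' : ∀ s < t, rangeProc X y z s ω < a := by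
      by_contra! hcon
      obtain ⟨s, hs, hsR⟩ := hcon
      obtain ⟨u, hu⟩ : ∃ u : ℝ≥0, tauR X y z a ω = u := by
        refine Option.ne_none_iff_exists'.1 (ne_top_of_le_ne_top WithTop.coe_ne_top
          ((passageUp_le_iff (rangeProc_rightCont hX y z)).2 ⟨s, le_rfl, hsR⟩))
      have hus : u ≤ s := by
        have := (passageUp_le_iff (rangeProc_rightCont hX y z)).2 ⟨s, le_rfl, hsR⟩
        rw [← tauR, hu] at this
        exact_mod_cast this
      obtain ⟨hu1, hu2⟩ := (passageUp_eq_iff (rangeProc_rightCont hX y z)).1 hu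
      obtain ⟨h1, h2⟩ := key u hu1 hu2 fun v hv => hU v (hv.trans_le (hus.trans hs.le))
      have := hD' u (hus.trans_lt hs)
      rw [rangeProc, min_eq_left (h1 ▸ h2), ← h1] at hu1
      exact this.not_ge hu1
    refine ⟨⟨hR, hR'⟩, fun s hs => ?_⟩
    rcases hs.eq_or_lt with rfl | hs
    · obtain ⟨h1, h2⟩ := key s hR hR' hU
      rw [drawup, ← h1, min_eq_left h2, sub_self]
      exact hb
    · exact hU s hs
  · rintro ⟨⟨hR, hR'⟩, hU⟩
    obtain ⟨h1, h2⟩ := key t hR hR' fun s hs => hU s hs.le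
    refine ⟨⟨?_, fun s hs => (drawdown_le_rangeProc hX y z s).trans_lt (hR' s hs)⟩,
      fun s hs => hU s hs.le⟩
    rwa [rangeProc, min_eq_left (h1 ▸ h2), ← h1] at hR

/-- The event in the numerator of the formula for `nu` is that the range has reached `a` before
the drawup reaches `b`. -/
lemma tauU_eq_and_range_iff (h0 : X 0 ω = 0) (hb : 0 < b) (hab : b < a) (hy : 0 ≤ y)
    (hz : 0 ≤ z) (hyz : y + z < a) :
    (tauU X z b ω = t ∧ a ≤ max (runSup X t ω) y - runInf X t ω ∧ runInf X t ω ≤ -z ∧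
      runSup X t ω ≤ b - z) ↔ (tauU X z b ω = t ∧ tauR X y z a ω < t) := by
  have key := fun t => eq_runInf_of_rangeProc (t := t) hX h0 hab hy hz hyz
  refine and_congr_right fun hτ => ?_
  obtain ⟨hU, hU'⟩ := (passageUp_eq_iff (drawup_regular hX z).rightCont).1 hτ
  constructor
  · rintro ⟨h1, h2, -⟩
    have hR : a ≤ rangeProc X y z t ω := by rwa [rangeProc, min_eq_left h2]
    refine lt_of_le_of_ne
      ((passageUp_le_iff (rangeProc_rightCont hX y z)).2 ⟨t, le_rfl, hR⟩) fun he => ?_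
    obtain ⟨hu1, hu2⟩ := (passageUp_eq_iff (rangeProc_rightCont hX y z)).1 he
    obtain ⟨h1, h2⟩ := key t hu1 hu2 hU'
    rw [drawup, ← h1, min_eq_left h2, sub_self] at hU
    exact hU.not_gt hb
  · intro hlt
    obtain ⟨u, hu⟩ := WithTop.ne_top_iff_exists.1 hlt.ne_top
    rw [← hu] at hlt
    have hut : u < t := by exact_mod_cast hlt
    obtain ⟨hu1, hu2⟩ := (passageUp_eq_iff (rangeProc_rightCont hX y z)).1 hu.symm
    obtain ⟨h1, h2⟩ := key u hu1 hu2 fun s hs => hU' s (hs.trans hut)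
    have hI : runInf X t ω ≤ -z := (runInf_le hX hut.le).trans h2
    refine ⟨?_, hI, runSup_le fun s hs => ?_⟩
    · have := hu1.trans (rangeProc_mono hX y z hut.le)
      simpa only [rangeProc, min_eq_left hI] using this
    · have : drawup X z s ω ≤ b := by
        rcases hs.eq_or_lt with rfl | hs
        · exact (drawup_regular hX z).le_of_forall_lt (pos_of_gt hut) fun v hv => (hU' v hv).le
        · exact (hU' s hs).le
      have h3 := min_le_right (runInf X s ω) (-z)
      rw [drawup] at this
      linarith

omit hX in
lemma restart_regular (hX : IsRegularPath fun t => X t ω) (t : ℝ≥0) :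
    IsRegularPath fun s => restart X t s ω where
  rightCont s := by
    refine ContinuousWithinAt.sub ?_ continuousWithinAt_const
    exact (hX.rightCont (t + s)).comp (f := fun s => t + s) (by fun_prop)
      fun u hu => add_le_add_right hu t
  leftLim s hs := by
    obtain ⟨l, hl, hle⟩ := hX.leftLim (t + s) (by positivity)
    refine ⟨l - X t ω, (hl.comp ?_).sub_const _, sub_le_sub_right hle _⟩
    refine tendsto_nhdsWithin_iff.2 ⟨?_, eventually_nhdsWithin_of_forall fun u hu => ?_⟩
    · exact ((continuous_const.add continuous_id).tendsto s).mono_left nhdsWithin_le_nhds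
    · exact add_lt_add_right hu t

/-- At a time at which the process is at its running minimum, the drawup process restarts
from `0`. -/
lemma drawup_add (h1 : X t ω = runInf X t ω) (h2 : X t ω ≤ -z) (s : ℝ≥0) :
    drawup X z (t + s) ω = drawup (restart X t) 0 s ω := by
  have hX' := restart_regular hX t
  have hI' : runInf (restart X t) s ω ≤ 0 := by
    refine (runInf_le hX' (zero_le (a := s))).trans ?_
    simp [restart]
  have hI : runInf X (t + s) ω ≤ X t ω := runInf_le hX le_self_add
  have hle : runInf X (t + s) ω ≤ runInf (restart X t) s ω + X t ω := by
    obtain ⟨u, hu, hu2⟩ := exists_eq_runInf hX' s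
    rw [← hu2, restart, sub_add_cancel]
    exact runInf_le hX (add_le_add_right hu t)
  have hge : runInf (restart X t) s ω + X t ω ≤ runInf X (t + s) ω := by
    obtain ⟨u, hu, hu2⟩ := exists_eq_runInf hX (t + s)
    rw [← hu2]
    rcases le_total u t with h | h
    · have := runInf_le hX h
      linarith
    · obtain ⟨v, rfl⟩ := exists_add_of_le h
      have := runInf_le hX' (le_of_add_le_add_left hu)
      rw [restart] at this
      linarith
  rw [drawup, drawup, min_eq_left (hI.trans h2), neg_zero, min_eq_left hI', restart]
  linarith

/-- For `a ≤ y + z`, the drawdown event is a two-sided exit: as long as `X` stays below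
`b - z < y` and above `y - a ≥ -z`, the historical extrema `y` and `-z` are not updated. -/
lemma tauD_eq_iff_of_le_add (h0 : X 0 ω = 0) (hab : b < a) (hyz : a ≤ y + z)
    (hne : y < a ∨ z < b) (hy : 0 ≤ y) :
    (tauD X y a ω = t ∧ t ≤ tauU X z b ω) ↔
      (passageDown X (y - a) ω = t ∧ t < passageUp X (b - z) ω) := by
  simp only [tauD, tauU, passageUp_eq_iff (drawdown_rightCont hX y),
    passageDown_eq_iff hX.rightCont, le_passageUp_iff (drawup_regular hX z).rightCont,
    lt_passageUp_iff hX.rightCont]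
  constructor
  · rintro ⟨⟨hD, hD'⟩, hU⟩
    have h1 : ∀ s < t, y - a < X s ω := fun s hs => by
      have := hD' s hs
      rw [drawdown] at this
      linarith [le_max_right (runSup X s ω) y]
    have h2 : ∀ s < t, X s ω < b - z := fun s hs => by
      have := hU s hs
      rw [drawup] at this
      linarith [min_le_right (runInf X s ω) (-z)]
    rcases eq_or_ne t 0 with rfl | ht
    · rw [drawdown, runSup_zero, h0, max_eq_right hy, sub_zero] at hD
      have hzb : z < b := hne.resolve_left hD.not_gt
      refine ⟨⟨by linarith, h1⟩, fun s hs => ?_⟩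
      rw [nonpos_iff_eq_zero.1 hs, h0]
      linarith
    · have ht := pos_iff_ne_zero.2 ht
      have h3 : X t ω ≤ b - z := hX.le_of_forall_lt ht fun s hs => (h2 s hs).le
      have h4 : runSup X t ω ≤ b - z := runSup_le fun s hs => by
        rcases hs.eq_or_lt with rfl | hs
        · exact h3
        · exact (h2 s hs).le
      rw [drawdown, max_eq_right (by linarith)] at hD
      have h5 := h1 0 ht
      have h6 := h2 0 ht
      rw [h0] at h5 h6
      refine ⟨⟨by linarith, h1⟩, fun s hs => ?_⟩
      rcases hs.eq_or_lt with rfl | hs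
      · linarith
      · exact h2 s hs
  · rintro ⟨⟨h1, h1'⟩, h2⟩
    refine ⟨⟨?_, fun s hs => ?_⟩, fun s hs => ?_⟩
    · rw [drawdown]
      linarith [le_max_right (runSup X t ω) y]
    · have h4 : runSup X s ω ≤ b - z := runSup_le fun u hu => (h2 u (hu.trans hs.le)).le
      rw [drawdown, max_eq_right (by linarith)]
      linarith [h1' s hs]
    · obtain ⟨u, hu, hu2⟩ := exists_eq_runInf hX s
      have h3 := h1' u (hu.trans_lt hs)
      rw [drawup, min_eq_right (by linarith)]
      linarith [h2 s hs.le]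

/-- A drawup of size `b` with the historical minimum `-z` not reached on the way is a
two-sided exit of `X`. -/
lemma tauU_eq_iff_of_lt_runInf (h0 : X 0 ω = 0) (hab : b < a) (hy : 0 ≤ y) :
    (tauU X z b ω = t ∧ t < tauD X y a ω ∧ -z < runInf X t ω) ↔
      (passageUp X (b - z) ω = t ∧ t < passageDown X (max (y - a) (-z)) ω) := by
  simp only [tauD, tauU, passageUp_eq_iff (drawup_regular hX z).rightCont,
    passageUp_eq_iff hX.rightCont, lt_passageUp_iff (drawdown_rightCont hX y),
    lt_passageDown_iff hX.rightCont]
  have hUX : -z < runInf X t ω → ∀ s ≤ t, drawup X z s ω = X s ω + z := fun h s hs => by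
    have := runInf_anti hX hs
    rw [drawup, min_eq_right (h.le.trans this), sub_neg_eq_add]
  constructor
  · rintro ⟨⟨hU, hU'⟩, hD, hI⟩
    refine ⟨⟨?_, fun s hs => ?_⟩, fun s hs => max_lt ?_ (hI.trans_le (runInf_le hX hs))⟩
    · rw [hUX hI t le_rfl] at hU
      linarith
    · have := hU' s hs
      rw [hUX hI s hs.le] at this
      linarith
    · have := hD s hs
      rw [drawdown] at this
      linarith [le_max_right (runSup X s ω) y]
  · rintro ⟨⟨h1, h1'⟩, h2⟩
    have hI : -z < runInf X t ω := by
      obtain ⟨u, hu, hu2⟩ := exists_eq_runInf hX t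
      rw [← hu2]
      exact (le_max_right _ _).trans_lt (h2 u hu)
    refine ⟨⟨?_, fun s hs => ?_⟩, fun s hs => ?_, hI⟩
    · rw [hUX hI t le_rfl]
      linarith
    · rw [hUX hI s hs.le]
      linarith [h1' s hs]
    · have h3 := h2 s hs
      rw [max_lt_iff] at h3
      rcases eq_or_ne s 0 with rfl | hs0
      · rw [drawdown, runSup_zero, h0, max_eq_right hy]
        linarith [h0 ▸ h3.1]
      · have h4 : ∀ u ≤ t, X u ω ≤ b - z := fun u hu => by
          rcases hu.eq_or_lt with rfl | hu
          · exact hX.le_of_forall_lt ((pos_iff_ne_zero.2 hs0).trans_le hs)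
              fun v hv => (h1' v hv).le
          · exact (h1' u hu).le
        have h5 : runSup X s ω ≤ b - z := runSup_le fun u hu => h4 u (hu.trans hs)
        rw [drawdown, sub_lt_iff_lt_add, max_lt_iff]
        constructor <;> linarith

/-- If the historical minimum `-z` is reached before the drawup time, then no drawdown of size
`a` comes before that time if and only if the range is still below `a`. -/
lemma tauU_lt_tauD_iff_of_runInf_le (h0 : X 0 ω = 0) (hab : b < a) (hy : 0 ≤ y)
    (hz : 0 ≤ z) (hτ : tauU X z b ω = t) (hI : runInf X t ω ≤ -z) :
    t < tauD X y a ω ↔ max (runSup X t ω) y - runInf X t ω < a := by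
  simp only [tauD, lt_passageUp_iff (drawdown_rightCont hX y)]
  obtain ⟨hU, hU'⟩ := (passageUp_eq_iff (drawup_regular hX z).rightCont).1 hτ
  constructor
  · intro hD
    by_contra! hR
    rcases le_or_gt a (y + z) with hyz | hyz
    · obtain ⟨u, hu, hu2⟩ := exists_eq_runInf hX t
      have := hD u hu
      rw [drawdown] at this
      linarith [le_max_right (runSup X u ω) y]
    · have hR : a ≤ rangeProc X y z t ω := by rwa [rangeProc, min_eq_left hI]
      have hle := (passageUp_le_iff (rangeProc_rightCont hX y z)).2 ⟨t, le_rfl, hR⟩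
      obtain ⟨u, hu⟩ := WithTop.ne_top_iff_exists.1 (ne_top_of_le_ne_top WithTop.coe_ne_top hle)
      rw [← hu] at hle
      have hut : u ≤ t := by exact_mod_cast hle
      obtain ⟨hu1, hu2⟩ := (passageUp_eq_iff (rangeProc_rightCont hX y z)).1 hu.symm
      obtain ⟨h1, h2⟩ := eq_runInf_of_rangeProc hX h0 hab hy hz hyz hu1 hu2
        fun s hs => hU' s (hs.trans_le hut)
      rw [rangeProc, min_eq_left (h1 ▸ h2), ← h1] at hu1
      exact (hD u hut).not_ge hu1
  · intro h s hs
    refine lt_of_le_of_lt (sub_le_sub (max_le_max ?_ le_rfl) (runInf_le hX hs)) h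
    exact runSup_mono hX.bddAbove hs

end Pathwise

section Markov

/-! ### The Markov property at a fixed time -/

/-- A Lévy process started at `0` all of whose paths are regular. -/
structure IsRegularLevy {Ω : Type*} [MeasurableSpace Ω] (X : ℝ≥0 → Ω → ℝ) (P : Measure Ω) :
    Prop where
  measurable : ∀ t, Measurable (X t)
  zero : ∀ ω, X 0 ω = 0
  indep : HasIndepIncrements X P
  stationary : ∀ s t, IdentDistrib (fun ω => X (s + t) ω - X s ω) (X t) P P
  regular : ∀ ω, IsRegularPath fun t => X t ω

variable {Ω : Type*} [MeasurableSpace Ω] {P : Measure Ω} [IsProbabilityMeasure P]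
  {X : ℝ≥0 → Ω → ℝ}

/-- A finite set of times is enumerated, together with `0`, by a monotone sequence; this is the
form in which independence of the increments is available. -/
lemma exists_monotone_seq (S : Finset ℝ≥0) :
    ∃ s : ℕ → ℝ≥0, Monotone s ∧ s 0 = 0 ∧ ∀ x ∈ S, ∃ m, s m = x := by
  set T := insert 0 S
  have hT : 0 < T.card := Finset.card_pos.2 ⟨0, by simp [T]⟩
  set s : ℕ → ℝ≥0 := fun m => T.orderEmbOfFin rfl ⟨min m (T.card - 1), by omega⟩
  have hs : Monotone s := fun m n hmn => (T.orderEmbOfFin rfl).monotone (by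
    rw [Fin.mk_le_mk]
    omega)
  have hmem : ∀ x ∈ T, ∃ m, s m = x := fun x hx => by
    have : x ∈ Set.range (T.orderEmbOfFin rfl) := by rwa [Finset.range_orderEmbOfFin]
    obtain ⟨m, rfl⟩ := this
    refine ⟨m, congrArg _ (Fin.ext ?_)⟩
    have := m.2
    grind
  refine ⟨s, hs, ?_, fun x hx => hmem x (Finset.mem_insert_of_mem hx)⟩
  obtain ⟨m, hm⟩ := hmem 0 (by simp [T])
  exact nonpos_iff_eq_zero.1 (hm ▸ hs (Nat.zero_le m))

lemma sum_coe_ite_lt (s : Finset ℕ) (m : ℕ) (f : ℕ → ℝ) :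
    (∑ l : s, if (l : ℕ) < m then f l else 0) = ∑ l ∈ s with l < m, f l := by
  rw [Finset.sum_coe_sort s fun l => if l < m then f l else 0, Finset.sum_filter]

/-- The law of the process `X`, observed at rational times. -/
noncomputable def ratLaw (X : ℝ≥0 → Ω → ℝ) (P : Measure Ω) : Measure (ℚ≥0 → ℝ) :=
  P.map fun ω q => X q ω

namespace IsRegularLevy

variable (hX : IsRegularLevy X P)
include hX

omit [IsProbabilityMeasure P] in
lemma measurable_restart (t s : ℝ≥0) : Measurable (restart X t s) :=
  (hX.measurable _).sub (hX.measurable _)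

omit [IsProbabilityMeasure P] in
lemma indepFun_restart_finset (t : ℝ≥0) (I : Finset (Set.Iic t)) (J : Finset ℚ≥0) :
    IndepFun (fun ω (i : I) => X i.1 ω) (fun ω (q : J) => restart X t (q : ℚ≥0) ω) P := by
  classical
  obtain ⟨s, hs, hs0, hmem⟩ := exists_monotone_seq
    (insert t (I.image (fun i : Set.Iic t => (i : ℝ≥0)) ∪ J.image fun q : ℚ≥0 => t + (q : ℝ≥0)))
  obtain ⟨k, hk⟩ := hmem t (by simp)
  -- The past is a function of the increments before the index `k`, the future of those after it.
  have hI : ∀ i : I, ∃ m ≤ k, s m = i.1 := fun i => by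
    obtain ⟨m, hm⟩ := hmem i.1 (by
      simp only [Finset.mem_insert, Finset.mem_union, Finset.mem_image]
      exact .inr (.inl ⟨i, i.2, rfl⟩))
    rcases le_total m k with h | h
    · exact ⟨m, h, hm⟩
    · exact ⟨k, le_rfl, le_antisymm (hm ▸ hs h) (hk ▸ i.1.2)⟩
  have hJ : ∀ q : J, ∃ m, k ≤ m ∧ s m = t + (q : ℚ≥0) := fun q => by
    obtain ⟨m, hm⟩ := hmem (t + (q : ℚ≥0)) (by
      simp only [Finset.mem_insert, Finset.mem_union, Finset.mem_image]
      exact .inr (.inr ⟨q, q.2, rfl⟩))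
    rcases le_total k m with h | h
    · exact ⟨m, h, hm⟩
    · exact ⟨k, le_rfl, le_antisymm (hk ▸ le_self_add) (hm ▸ hs h)⟩
  choose mI hmI hmI' using hI
  choose mJ hmJ hmJ' using hJ
  set N := Finset.univ.sup mJ
  set Δ : ℕ → Ω → ℝ := fun i ω => X (s (i + 1)) ω - X (s i) ω
  have hΔ : ∀ i, Measurable (Δ i) := fun i => (hX.measurable _).sub (hX.measurable _)
  have hsum : ∀ m ω, ∑ l ∈ Finset.range m, Δ l ω = X (s m) ω := fun m ω => by
    rw [Finset.sum_range_sub (fun l => X (s l) ω), hs0, hX.zero, sub_zero]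
  have hdisj : Disjoint (Finset.range k) (Finset.Ico k N) := by
    rw [Finset.disjoint_left]
    intro x hx hx'
    simp only [Finset.mem_range, Finset.mem_Ico] at hx hx'
    omega
  have hind := (hX.indep.nat hs).indepFun_finset _ _ hdisj hΔ
  have hcomp := hind.comp
    (φ := fun v (i : I) => ∑ l : Finset.range k, if (l : ℕ) < mI i then v l else 0)
    (ψ := fun v (q : J) => ∑ l : Finset.Ico k N, if (l : ℕ) < mJ q then v l else 0)
    (by
      refine measurable_pi_lambda _ fun i => Finset.measurable_sum _ fun l _ => ?_
      split_ifs <;> fun_prop)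
    (by
      refine measurable_pi_lambda _ fun i => Finset.measurable_sum _ fun l _ => ?_
      split_ifs <;> fun_prop)
  convert hcomp using 1
  · ext ω i
    simp only [Function.comp]
    rw [sum_coe_ite_lt _ _ fun l => Δ l ω, ← hmI' i, ← hsum]
    refine Finset.sum_congr ?_ fun _ _ => rfl
    ext l
    have := hmI i
    simp only [Finset.mem_filter, Finset.mem_range]
    omega
  · ext ω q
    simp only [Function.comp]
    have h1 : Finset.filter (· < mJ q) (Finset.Ico k N) = Finset.Ico k (mJ q) := by
      ext l
      have : mJ q ≤ N := Finset.le_sup (Finset.mem_univ q)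
      simp only [Finset.mem_filter, Finset.mem_Ico]
      omega
    rw [sum_coe_ite_lt _ _ fun l => Δ l ω, h1, Finset.sum_Ico_eq_sub _ (hmJ q), hsum, hsum,
      hmJ' q, hk, restart]

omit [IsProbabilityMeasure P] in
lemma identDistrib_restart_finset (t : ℝ≥0) (J : Finset ℚ≥0) :
    IdentDistrib (fun ω (q : J) => restart X t (q : ℚ≥0) ω) (fun ω (q : J) => X (q : ℚ≥0) ω)
      P P := by
  classical
  obtain ⟨s, hs, hs0, hmem⟩ := exists_monotone_seq (J.image fun q : ℚ≥0 => (q : ℝ≥0))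
  have hJ : ∀ q : J, ∃ m, s m = (q : ℚ≥0) := fun q => hmem _ (Finset.mem_image_of_mem _ q.2)
  choose m hm using hJ
  have h1 := hX.indep.nat (t := fun i => t + s i) fun i j hij => add_le_add_right (hs hij) t
  have h2 := hX.indep.nat hs
  have hid : ∀ i, IdentDistrib (fun ω => X (t + s (i + 1)) ω - X (t + s i) ω)
      (fun ω => X (s (i + 1)) ω - X (s i) ω) P P := fun i => by
    obtain ⟨d, hd⟩ := exists_add_of_le (hs (Nat.le_succ i))
    have e1 := hX.stationary (t + s i) d
    have e2 := hX.stationary (s i) d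
    rw [add_assoc, ← hd] at e1
    rw [← hd] at e2
    exact e1.trans e2.symm
  have h3 := (IdentDistrib.pi hid h1 h2).comp
    (u := fun (v : ℕ → ℝ) (q : J) => ∑ l ∈ Finset.range (m q), v l) (by fun_prop)
  convert h3 using 1
  · ext ω q
    simp only [Function.comp]
    rw [Finset.sum_range_sub (fun l => X (t + s l) ω), hs0, hm, restart, add_zero]
  · ext ω q
    simp only [Function.comp]
    rw [Finset.sum_range_sub (fun l => X (s l) ω), hs0, hX.zero, sub_zero, hm]

/-- The natural filtration of the process. -/
noncomputable def filtration : Filtration ℝ≥0 (inferInstance : MeasurableSpace Ω) :=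
  Filtration.natural X fun t => (hX.measurable t).stronglyMeasurable

omit [IsProbabilityMeasure P] in
lemma measurable_filtration {s t : ℝ≥0} (hst : s ≤ t) : Measurable[hX.filtration t] (X s) := by
  refine Measurable.mono (comap_measurable (X s)) ?_ le_rfl
  exact le_iSup₂_of_le (f := fun j (_ : j ≤ t) => MeasurableSpace.comap (X j) _) s hst le_rfl

omit [IsProbabilityMeasure P] in
lemma measurable_ratPath : Measurable fun ω (q : ℚ≥0) => X q ω :=
  measurable_pi_lambda _ fun _ => hX.measurable _

lemma isProbabilityMeasure_ratLaw : IsProbabilityMeasure (ratLaw X P) :=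
  Measure.isProbabilityMeasure_map hX.measurable_ratPath.aemeasurable

lemma map_restart (t : ℝ≥0) : P.map (fun ω (q : ℚ≥0) => restart X t q ω) = ratLaw X P :=
  (map_eq_iff_forall_finset_map_restrict_eq
    (X := fun (q : ℚ≥0) ω => restart X t q ω) (Y := fun (q : ℚ≥0) ω => X q ω)
    (measurable_pi_lambda _ fun _ => hX.measurable_restart _ _).aemeasurable
    hX.measurable_ratPath.aemeasurable).2
    fun J => (hX.identDistrib_restart_finset t J).map_eq

/-- Simple Markov property. -/
lemma measure_inter_restart (t : ℝ≥0) {A : Set Ω} (hA : MeasurableSet[hX.filtration t] A)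
    {B : Set (ℚ≥0 → ℝ)} (hB : MeasurableSet B) :
    P (A ∩ {ω | (fun q : ℚ≥0 => restart X t q ω) ∈ B}) = P A * ratLaw X P B := by
  have h := IndepFun.process_indepFun_process (P := P)
    (X := fun (i : Set.Iic t) ω => X i ω) (Y := fun (q : ℚ≥0) ω => restart X t q ω)
    (fun i => hX.measurable i) (fun q => hX.measurable_restart t q) (hX.indepFun_restart_finset t)
  rw [filtration, Filtration.natural_eq_comap] at hA
  obtain ⟨C, hC, rfl⟩ := hA
  have := h.measure_inter_preimage_eq_mul C B hC hB
  rw [← hX.map_restart t, Measure.map_apply (measurable_pi_lambda _ fun _ =>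
    hX.measurable_restart _ _) hB]
  exact this

end IsRegularLevy

end Markov

section StrongMarkov

variable {Ω : Type*} [MeasurableSpace Ω] {P : Measure Ω} [IsProbabilityMeasure P]
  {X : ℝ≥0 → Ω → ℝ}

/-! ### The strong Markov property -/

/-- The point `(k + 1) / (n + 1)` of the grid of mesh `1 / (n + 1)`. -/
noncomputable def gridPoint (n k : ℕ) : ℝ≥0 := (k + 1) / (n + 1)

/-- The first point of the grid of mesh `1 / (n + 1)` after `u`. -/
noncomputable def nextGrid (n : ℕ) (u : ℝ≥0) : ℝ≥0 := gridPoint n ⌊(n + 1) * u⌋₊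

lemma lt_nextGrid (n : ℕ) (u : ℝ≥0) : u < nextGrid n u := by
  rw [nextGrid, gridPoint, lt_div_iff₀ (by positivity), mul_comm]
  exact Nat.lt_floor_add_one _

lemma nextGrid_le (n : ℕ) (u : ℝ≥0) : nextGrid n u ≤ u + 1 / (n + 1) := by
  rw [nextGrid, gridPoint, div_le_iff₀ (by positivity),
    add_mul u, div_mul_cancel₀ _ (by positivity), mul_comm u]
  gcongr
  exact Nat.floor_le (by positivity)

lemma tendsto_nextGrid (u s : ℝ≥0) :
    Tendsto (fun n => nextGrid n u + s) atTop (𝓝[≥] (u + s)) := by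
  refine tendsto_nhdsWithin_iff.2 ⟨?_, .of_forall fun n => add_le_add_left (lt_nextGrid n u).le s⟩
  refine Tendsto.add_const s ?_
  refine tendsto_of_tendsto_of_tendsto_of_le_of_le tendsto_const_nhds ?_
    (fun n => (lt_nextGrid n u).le) fun n => nextGrid_le n u
  simpa using (tendsto_const_nhds (x := u)).add
    (tendsto_one_div_add_atTop_nhds_zero_nat (𝕜 := ℝ≥0))

lemma floor_eq_iff_mem (n k : ℕ) (u : ℝ≥0) :
    ⌊(n + 1) * u⌋₊ = k ↔ u < gridPoint n k ∧ ¬ u < (k / (n + 1) : ℝ≥0) := by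
  rw [Nat.floor_eq_iff (by positivity), gridPoint, lt_div_iff₀ (by positivity), not_lt,
    div_le_iff₀ (by positivity), mul_comm, and_comm]

namespace IsRegularLevy

variable (hX : IsRegularLevy X P)
include hX

omit [IsProbabilityMeasure P]

lemma measurable_eval_nextGrid {T : Ω → ℝ≥0} (hT : Measurable T) (n : ℕ) (s : ℝ≥0) :
    Measurable fun ω => X (nextGrid n (T ω) + s) ω := by
  have h1 : Measurable fun p : ℕ × Ω => X (gridPoint n p.1 + s) p.2 :=
    measurable_from_prod_countable_right fun k => hX.measurable (gridPoint n k + s)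
  have h2 : Measurable fun ω => ⌊(n + 1) * T ω⌋₊ := Nat.measurable_floor.comp (hT.const_mul _)
  have h3 := h1.comp (h2.prodMk measurable_id)
  simpa only [Function.comp_def, nextGrid, id_eq] using h3

lemma tendsto_eval_nextGrid (u s : ℝ≥0) (ω : Ω) :
    Tendsto (fun n => X (nextGrid n u + s) ω) atTop (𝓝 (X (u + s) ω)) :=
  ((hX.regular ω).rightCont (u + s)).tendsto.comp (tendsto_nextGrid u s)

lemma measurable_eval {T : Ω → ℝ≥0} (hT : Measurable T) (s : ℝ≥0) :
    Measurable fun ω => X (T ω + s) ω :=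
  measurable_of_tendsto_metrizable (fun n => hX.measurable_eval_nextGrid hT n s)
    (tendsto_pi_nhds.2 fun ω => hX.tendsto_eval_nextGrid (T ω) s ω)

lemma measurable_restart_time {T : Ω → ℝ≥0} (hT : Measurable T) :
    Measurable fun ω (q : ℚ≥0) => restart X (T ω) q ω :=
  measurable_pi_lambda _ fun q => (hX.measurable_eval hT q).sub
    (by simpa using hX.measurable_eval hT 0)

lemma measurable_restart_nextGrid {T : Ω → ℝ≥0} (hT : Measurable T) (n : ℕ) :
    Measurable fun ω (q : ℚ≥0) => restart X (nextGrid n (T ω)) q ω :=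
  measurable_pi_lambda _ fun q => (hX.measurable_eval_nextGrid hT n q).sub
    (by simpa using hX.measurable_eval_nextGrid hT n 0)

variable [IsProbabilityMeasure P]

/-- The strong Markov property at the grid point following a stopping time; the stopping time
takes countably many values after this discretisation. -/
lemma map_restart_nextGrid {τ : Ω → WithTop ℝ≥0} (hτ : IsStoppingTime hX.filtration τ) {A : Set Ω}
    (hA : MeasurableSet[hτ.measurableSpace] A) (hAτ : ∀ ω ∈ A, τ ω ≠ ⊤) (n : ℕ) :
    (P.restrict A).map (fun ω (q : ℚ≥0) => restart X (nextGrid n ((τ ω).untopD 0)) q ω) =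
      P A • ratLaw X P := by
  have hT : Measurable fun ω => (τ ω).untopD 0 := hτ.measurable'.untopD 0
  have hAm : MeasurableSet A := hτ.measurableSpace_le A hA
  have hm := hX.measurable_restart_nextGrid hT n
  ext B hB
  rw [Measure.map_apply hm hB, Measure.restrict_apply (hm hB), Measure.smul_apply, smul_eq_mul]
  set N : Ω → ℕ := fun ω => ⌊(n + 1) * (τ ω).untopD 0⌋₊
  have hN : Measurable N := Nat.measurable_floor.comp (hT.const_mul _)
  have hAk : ∀ k, MeasurableSet[hX.filtration (gridPoint n k)] (A ∩ N ⁻¹' {k}) := fun k => by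
    have hle : (k / (n + 1) : ℝ≥0) ≤ gridPoint n k := by
      rw [gridPoint]
      gcongr
      exact le_self_add
    have : A ∩ N ⁻¹' {k} = (A ∩ {ω | τ ω ≤ gridPoint n k}) ∩ ({ω | τ ω < gridPoint n k} \
        {ω | τ ω < (k / (n + 1) : ℝ≥0)}) := by
      ext ω
      simp only [Set.mem_inter_iff, Set.mem_preimage, Set.mem_singleton_iff, Set.mem_sdiff,
        Set.mem_ofPred_eq, N, floor_eq_iff_mem]
      refine ⟨fun ⟨h1, h2, h3⟩ => ?_, fun ⟨⟨h1, _⟩, h2, h3⟩ => ?_⟩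
      all_goals
        obtain ⟨u, hu⟩ := WithTop.ne_top_iff_exists.1 (hAτ ω h1)
        simp only [← hu, WithTop.coe_lt_coe, WithTop.coe_le_coe, WithTop.untopD_coe] at *
      · exact ⟨⟨h1, h2.le⟩, h2, h3⟩
      · exact ⟨h1, h2, h3⟩
    rw [this]
    exact (((hτ.measurableSet A).1 hA).2 _).inter
      ((hτ.measurableSet_lt _).diff (hτ.measurableSet_lt_le hle))
  set S : ℕ → Set Ω := fun k => (A ∩ N ⁻¹' {k}) ∩ {ω | (fun q : ℚ≥0 =>
    restart X (gridPoint n k) q ω) ∈ B}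
  have hunion : (fun ω (q : ℚ≥0) => restart X (nextGrid n ((τ ω).untopD 0)) q ω) ⁻¹' B ∩ A =
      ⋃ k, S k := by
    ext ω
    simp only [Set.mem_inter_iff, Set.mem_preimage, Set.mem_iUnion, S, Set.mem_singleton_iff,
      Set.mem_ofPred_eq]
    constructor
    · rintro ⟨h1, h2⟩
      exact ⟨N ω, ⟨h2, rfl⟩, h1⟩
    · rintro ⟨k, ⟨h2, rfl⟩, h1⟩
      exact ⟨h1, h2⟩
  have hunion' : A = ⋃ k, A ∩ N ⁻¹' {k} := by
    ext ω
    simp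
  have hdisj : Pairwise (Function.onFun Disjoint fun k => A ∩ N ⁻¹' {k}) := fun i j hij => by
    refine Set.disjoint_left.2 fun ω h1 h2 => hij ?_
    exact h1.2.symm.trans h2.2
  rw [hunion, measure_iUnion]
  · simp_rw [S, hX.measure_inter_restart _ (hAk _) hB]
    rw [ENNReal.tsum_mul_right, ← measure_iUnion hdisj
      fun k => hAm.inter (hN (measurableSet_singleton k)), ← hunion']
  · exact fun i j hij => (hdisj hij).mono Set.inter_subset_left Set.inter_subset_left
  · exact fun k => (hAm.inter (hN (measurableSet_singleton k))).inter
      ((measurable_pi_lambda _ fun _ => hX.measurable_restart _ _) hB)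

/-- **Strong Markov property**: after a finite stopping time the process starts afresh,
independently of the past. -/
theorem map_restart_stoppingTime {τ : Ω → WithTop ℝ≥0} (hτ : IsStoppingTime hX.filtration τ)
    {A : Set Ω} (hA : MeasurableSet[hτ.measurableSpace] A) (hAτ : ∀ ω ∈ A, τ ω ≠ ⊤) :
    (P.restrict A).map (fun ω (q : ℚ≥0) => restart X ((τ ω).untopD 0) q ω) =
      P A • ratLaw X P := by
  have hT : Measurable fun ω => (τ ω).untopD 0 := hτ.measurable'.untopD 0
  have := hX.isProbabilityMeasure_ratLaw
  have hfin : IsFiniteMeasure (P A • ratLaw X P) := Measure.smul_finite _ (measure_ne_top _ _)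
  refine ext_of_forall_integral_eq_of_IsFiniteMeasure fun f => ?_
  rw [integral_map (hX.measurable_restart_time hT).aemeasurable
    f.continuous.aestronglyMeasurable]
  have hlim : Tendsto (fun n => ∫ ω, f (fun q : ℚ≥0 => restart X (nextGrid n ((τ ω).untopD 0)) q ω)
      ∂P.restrict A) atTop (𝓝 (∫ ω, f (fun q : ℚ≥0 => restart X ((τ ω).untopD 0) q ω)
      ∂P.restrict A)) := by
    refine tendsto_integral_of_dominated_convergence (fun _ => ‖f‖) (fun n => ?_)
      (integrable_const _) (fun n => .of_forall fun ω => f.norm_coe_le_norm _)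
      (.of_forall fun ω => ?_)
    · exact (f.continuous.measurable.comp
        (hX.measurable_restart_nextGrid hT n)).aestronglyMeasurable
    · refine (f.continuous.tendsto _).comp (tendsto_pi_nhds.2 fun q => ?_)
      exact (hX.tendsto_eval_nextGrid _ _ ω).sub
        (by simpa using hX.tendsto_eval_nextGrid ((τ ω).untopD 0) 0 ω)
  refine tendsto_nhds_unique hlim (tendsto_const_nhds.congr fun n => ?_)
  rw [← hX.map_restart_nextGrid hτ hA hAτ n, integral_map
    (hX.measurable_restart_nextGrid hT n).aemeasurable f.continuous.aestronglyMeasurable]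

end IsRegularLevy

end StrongMarkov

section QuasiLeftContinuity

variable {Ω : Type*}

/-! ### Passage times of the running supremum -/

section Announce

variable {X Y : ℝ≥0 → Ω → ℝ} {ω : Ω} {t : ℝ≥0} {c : ℝ}

lemma passageUp_runSup_le_iff (hY : IsRegularPath fun t => Y t ω) :
    passageUp (runSup Y) c ω ≤ t ↔ c ≤ runSup Y t ω := by
  rw [passageUp_le_iff (runSup_rightCont hY.bddAbove hY.rightCont)]
  exact ⟨fun ⟨s, hs, h⟩ => h.trans (runSup_mono hY.bddAbove hs), fun h => ⟨t, le_rfl, h⟩⟩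

lemma passageUp_runSup_le (hY : IsRegularPath fun t => Y t ω) :
    passageUp (runSup Y) c ω ≤ passageUp Y c ω := by
  rcases h : passageUp Y c ω with _ | u
  · exact le_top
  · obtain ⟨h1, -⟩ := (passageUp_eq_iff hY.rightCont).1 h
    exact (passageUp_runSup_le_iff hY).2 (h1.trans (hY.le_runSup le_rfl))

/-- If the running supremum reaches a level strictly before the process does, then the process
jumps down at that moment; the passage times of the lower levels `c - 1 / (n + 1)` announce this
jump, which is therefore visible immediately after them. -/
lemma exists_eventually_restart_lt (hX : IsRegularPath fun t => X t ω)
    (hY : IsRegularPath fun t => Y t ω)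
    (hjump : ∀ t, 0 < t → ∀ l m, Tendsto (fun s => X s ω) (𝓝[<] t) (𝓝 l) →
      Tendsto (fun s => Y s ω) (𝓝[<] t) (𝓝 m) → m - Y t ω ≤ l - X t ω)
    (hne : passageUp Y c ω ≠ passageUp (runSup Y) c ω) :
    ∃ k : ℕ, ∀ j : ℕ, ∀ᶠ n : ℕ in atTop, passageUp (runSup Y) (c - 1 / (n + 1)) ω ≠ ⊤ ∧
      ∃ q : ℚ≥0, (q : ℝ≥0) < 1 / (j + 1) ∧
        restart X ((passageUp (runSup Y) (c - 1 / (n + 1)) ω).untopD 0) q ω < - (1 / (k + 1)) := by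
  have hlt := lt_of_le_of_ne (passageUp_runSup_le (c := c) hY) hne.symm
  obtain ⟨u, hu⟩ := WithTop.ne_top_iff_exists.1 hlt.ne_top
  obtain ⟨h1, h2⟩ :=
    (passageUp_eq_iff (runSup_rightCont hY.bddAbove hY.rightCont)).1 hu.symm
  rw [← hu, lt_passageUp_iff hY.rightCont] at hlt
  have hu0 : 0 < u := by
    rw [pos_iff_ne_zero]
    rintro rfl
    rw [runSup_zero] at h1
    exact (hlt 0 le_rfl).not_ge h1
  have hbot : (𝓝[<] u).NeBot := nhdsLT_neBot_of_exists_lt ⟨0, hu0⟩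
  obtain ⟨l, hl, -⟩ := hX.leftLim u hu0
  obtain ⟨m, hm, -⟩ := hY.leftLim u hu0
  have hcm : c ≤ m := by
    by_contra! hmc
    obtain ⟨d, hd1, hd2⟩ := exists_between hmc
    obtain ⟨v, hv, hsub⟩ := (mem_nhdsLT_iff_exists_Ioo_subset' hu0).1
      (hm.eventually (gt_mem_nhds hd1))
    have : runSup Y u ω ≤ max (runSup Y v ω) (max d (Y u ω)) := runSup_le fun s hs => by
      rcases hs.eq_or_lt with rfl | hs
      · exact le_max_of_le_right (le_max_right _ _)
      rcases le_or_gt s v with hsv | hsv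
      · exact le_max_of_le_left (hY.le_runSup hsv)
      · exact le_max_of_le_right (le_max_of_le_left (hsub ⟨hsv, hs⟩ : Y s ω < d).le)
    exact (h1.trans this).not_gt (max_lt (h2 v hv) (max_lt hd2 (hlt u le_rfl)))
  have hpos : 0 < l - X u ω := by linarith [hjump u hu0 l m hl hm, hlt u le_rfl]
  obtain ⟨k, hk⟩ := exists_nat_one_div_lt hpos
  obtain ⟨v, hv, hsub⟩ := (mem_nhdsLT_iff_exists_Ioo_subset' hu0).1
    (hl.eventually (lt_mem_nhds (show X u ω + 1 / (k + 1) < l by linarith)))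
  refine ⟨k, fun j => ?_⟩
  set w := max v (u - 1 / (j + 1))
  have hw : w < u := max_lt hv (tsub_lt_self hu0 (by positivity))
  have hev : ∀ᶠ n : ℕ in atTop, (1 : ℝ) / (n + 1) < c - runSup Y w ω :=
    tendsto_one_div_add_atTop_nhds_zero_nat.eventually (gt_mem_nhds (sub_pos.2 (h2 w hw)))
  filter_upwards [hev] with n hn
  have hlow : (w : WithTop ℝ≥0) < passageUp (runSup Y) (c - 1 / (n + 1)) ω := by
    rw [← not_le, passageUp_runSup_le_iff hY, not_le]
    linarith
  have hup : passageUp (runSup Y) (c - 1 / (n + 1)) ω < u := by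
    obtain ⟨s, hs, hsu⟩ := ((hm.eventually (lt_mem_nhds (show c - 1 / (n + 1) < m by
      have : (0 : ℝ) < 1 / (n + 1) := by positivity
      linarith))).and self_mem_nhdsWithin).exists
    refine ((passageUp_runSup_le_iff hY).2 (hs.le.trans (hY.le_runSup le_rfl))).trans_lt ?_
    exact_mod_cast hsu
  obtain ⟨T, hT⟩ := WithTop.ne_top_iff_exists.1 hup.ne_top
  rw [← hT] at hlow hup ⊢
  have hwT : w < T := by exact_mod_cast hlow
  have hTu : T < u := by exact_mod_cast hup
  refine ⟨WithTop.coe_ne_top, ?_⟩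
  rw [WithTop.untopD_coe]
  have hXT : X u ω + 1 / (k + 1) < X T ω := hsub ⟨(le_max_left _ _).trans_lt hwT, hTu⟩
  have hq : u - T < 1 / (j + 1) := by
    have h4 : u - 1 / (j + 1) < T := (le_max_right _ _).trans_lt hwT
    rw [tsub_lt_iff_right hTu.le]
    exact lt_add_of_tsub_lt_left h4
  have hval : 1 / (k + 1) < - restart X T (u - T) ω := by
    rw [restart, add_tsub_cancel_of_le hTu.le]
    linarith
  obtain ⟨r, -, hr1, hr2⟩ := exists_rat_lt_of_lt
    (((restart_regular hX T).rightCont (u - T)).neg) hval hq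
  exact ⟨r, hr1, lt_neg.1 hr2⟩

end Announce

lemma measurable_runSup {_ : MeasurableSpace Ω} {Y : ℝ≥0 → Ω → ℝ} {t : ℝ≥0}
    (hm : ∀ s ≤ t, Measurable (Y s))
    (hb : ∀ ω, BddAbove ((fun u => Y u ω) '' Set.Iic t))
    (hc : ∀ ω s, ContinuousWithinAt (fun u => Y u ω) (Set.Ici s) s) :
    Measurable (runSup Y t) := by
  refine measurable_of_Ioi fun c => ?_
  have : runSup Y t ⁻¹' Set.Ioi c =
      Y t ⁻¹' Set.Ioi c ∪ ⋃ (q : ℚ≥0) (_ : (q : ℝ≥0) ≤ t), Y q ⁻¹' Set.Ioi c := by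
    ext ω
    simp only [Set.mem_preimage, Set.mem_Ioi, lt_runSup_iff (hb ω), Set.mem_union,
      Set.mem_iUnion, exists_prop]
    constructor
    · rintro ⟨s, hs, h⟩
      rcases hs.eq_or_lt with rfl | hs
      · exact .inl h
      · obtain ⟨r, -, hr, hr2⟩ := exists_rat_lt_of_lt (hc ω s) h hs
        exact .inr ⟨r, hr.le, hr2⟩
    · rintro (h | ⟨q, hq, h⟩)
      · exact ⟨t, le_rfl, h⟩
      · exact ⟨q, hq, h⟩
  rw [this]
  exact (hm t le_rfl measurableSet_Ioi).union
    (.iUnion fun q => .iUnion fun hq => hm q hq measurableSet_Ioi)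

variable [MeasurableSpace Ω] {P : Measure Ω} {X Y : ℝ≥0 → Ω → ℝ}

/-- The paths that fall below `-1 / (k + 1)` before the time `1 / (j + 1)`. -/
def fallSet (k j : ℕ) : Set (ℚ≥0 → ℝ) :=
  {w | ∃ q : ℚ≥0, (q : ℝ≥0) < 1 / (j + 1) ∧ w q < - (1 / (k + 1))}

lemma measurableSet_fallSet (k j : ℕ) : MeasurableSet (fallSet k j) := by
  have : fallSet k j = ⋃ (q : ℚ≥0) (_ : (q : ℝ≥0) < 1 / (j + 1)),
      (fun w : ℚ≥0 → ℝ => w q) ⁻¹' Set.Iio (- (1 / (k + 1))) := by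
    ext w
    simp [fallSet]
  rw [this]
  exact .iUnion fun q => .iUnion fun _ => measurable_pi_apply q measurableSet_Iio

namespace IsRegularLevy

variable (hX : IsRegularLevy X P)
include hX

lemma measurable_runSup {s t : ℝ≥0} (hst : s ≤ t) : Measurable[hX.filtration t] (runSup X s) :=
  DrawdownInsurance.measurable_runSup (fun _ hu => hX.measurable_filtration (hu.trans hst))
    (fun ω => (hX.regular ω).bddAbove s) fun ω => (hX.regular ω).rightCont

lemma measurable_runInf {s t : ℝ≥0} (hst : s ≤ t) : Measurable[hX.filtration t] (runInf X s) := by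
  have : runInf X s = fun ω => - runSup (fun t ω => - X t ω) s ω :=
    funext fun ω => runInf_eq_neg X s ω
  rw [this]
  refine (DrawdownInsurance.measurable_runSup
    (fun _ hu => (hX.measurable_filtration (hu.trans hst)).neg)
    (fun ω => ?_) fun ω t => ((hX.regular ω).rightCont t).neg).neg
  obtain ⟨m, hm⟩ := (hX.regular ω).bddBelow s
  exact ⟨-m, by rintro _ ⟨u, hu, rfl⟩; exact neg_le_neg (hm ⟨u, hu, rfl⟩)⟩

lemma measurable_drawup (z : ℝ) {s t : ℝ≥0} (hst : s ≤ t) :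
    Measurable[hX.filtration t] (drawup X z s) :=
  (hX.measurable_filtration hst).sub ((hX.measurable_runInf hst).min measurable_const)

lemma isStoppingTime_passageUp_runSup (hY : ∀ ω, IsRegularPath fun t => Y t ω)
    (hYm : ∀ s t, s ≤ t → Measurable[hX.filtration t] (Y s)) (c : ℝ) :
    IsStoppingTime hX.filtration (passageUp (runSup Y) c) := fun t => by
  simp only [passageUp_runSup_le_iff (hY _)]
  exact DrawdownInsurance.measurable_runSup (fun s hs => hYm s t hs)
    (fun ω => (hY ω).bddAbove t) (fun ω => (hY ω).rightCont) measurableSet_Ici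

lemma isStoppingTime_tauR (y z a : ℝ) : IsStoppingTime hX.filtration (tauR X y z a) := fun t => by
  have : ∀ ω, tauR X y z a ω ≤ t ↔ a ≤ rangeProc X y z t ω := fun ω => by
    rw [tauR, passageUp_le_iff (rangeProc_rightCont (hX.regular ω) y z)]
    exact ⟨fun ⟨s, hs, h⟩ => h.trans (rangeProc_mono (hX.regular ω) y z hs),
      fun h => ⟨t, le_rfl, h⟩⟩
  simp only [this]
  have hm : Measurable[hX.filtration t] (rangeProc X y z t) :=
    ((hX.measurable_runSup le_rfl).max measurable_const).sub
      ((hX.measurable_runInf le_rfl).min measurable_const)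
  exact hm measurableSet_Ici

lemma isStoppingTime_passageDown (c : ℝ) :
    IsStoppingTime hX.filtration (passageDown X c) := fun t => by
  have : ∀ ω, passageDown X c ω ≤ t ↔ runInf X t ω ≤ c := fun ω => by
    rw [passageDown_le_iff (hX.regular ω).rightCont]
    constructor
    · rintro ⟨s, hs, h⟩
      exact (runInf_le (hX.regular ω) hs).trans h
    · obtain ⟨s, hs, h⟩ := exists_eq_runInf (hX.regular ω) t
      exact fun h' => ⟨s, hs, h.trans_le h'⟩
  simp only [this]
  exact hX.measurable_runInf le_rfl measurableSet_Iic

variable [IsProbabilityMeasure P]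

/-- By right-continuity at `0`, immediate falls of a given size are unlikely. -/
lemma tendsto_ratLaw_fallSet (k : ℕ) :
    Tendsto (fun j => ratLaw X P (fallSet k j)) atTop (𝓝 0) := by
  have := hX.isProbabilityMeasure_ratLaw
  have hm : ∀ j, ratLaw X P (fallSet k j) = P {ω | (fun q : ℚ≥0 => X q ω) ∈ fallSet k j} :=
    fun j => Measure.map_apply hX.measurable_ratPath (measurableSet_fallSet k j)
  simp only [hm]
  have hempty : ⋂ j, {ω | (fun q : ℚ≥0 => X q ω) ∈ fallSet k j} = ∅ := by
    refine Set.eq_empty_iff_forall_notMem.2 fun ω hω => ?_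
    rw [Set.mem_iInter] at hω
    have h0 : -(1 / ((k : ℝ) + 1)) < X 0 ω := by
      rw [hX.zero, neg_lt_zero]
      positivity
    have hev := ((hX.regular ω).rightCont 0).eventually (lt_mem_nhds h0)
    obtain ⟨u, hu, hsub⟩ := mem_nhdsGE_iff_exists_Ico_subset.1 hev
    obtain ⟨j, hj⟩ := exists_nat_one_div_lt (K := ℝ≥0) hu
    obtain ⟨q, hq1, hq2⟩ := hω j
    exact hq2.not_gt (hsub ⟨bot_le, hq1.trans hj⟩)
  rw [← measure_empty (μ := P), ← hempty]
  refine tendsto_measure_iInter_atTop (fun j => ?_) (fun i j hij ω ⟨q, h1, h2⟩ =>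
    ⟨q, h1.trans_le ?_, h2⟩) ⟨0, measure_ne_top _ _⟩
  · exact (hX.measurable_ratPath (measurableSet_fallSet k j)).nullMeasurableSet
  · exact one_div_le_one_div_of_le (by positivity) (by gcongr)

/-- A level is almost surely reached as soon as it is reached by the running supremum. This is
the quasi-left-continuity of `X`: the process almost surely does not jump at a time announced by
stopping times. Since `passageUp Y c` is not a Borel functional of the path, its measurability up
to null sets rests on this. -/
theorem passageUp_ae_eq (hY : ∀ ω, IsRegularPath fun t => Y t ω)
    (hYm : ∀ s t, s ≤ t → Measurable[hX.filtration t] (Y s))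
    (hjump : ∀ ω t, 0 < t → ∀ l m, Tendsto (fun s => X s ω) (𝓝[<] t) (𝓝 l) →
      Tendsto (fun s => Y s ω) (𝓝[<] t) (𝓝 m) → m - Y t ω ≤ l - X t ω) (c : ℝ) :
    passageUp Y c =ᵐ[P] passageUp (runSup Y) c := by
  set τ : ℕ → Ω → WithTop ℝ≥0 := fun n => passageUp (runSup Y) (c - 1 / (n + 1))
  have hτ : ∀ n, IsStoppingTime hX.filtration (τ n) := fun n =>
    hX.isStoppingTime_passageUp_runSup hY hYm _
  set E : ℕ → ℕ → ℕ → Set Ω := fun k j n => {ω | τ n ω ≠ ⊤ ∧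
    (fun q : ℚ≥0 => restart X ((τ n ω).untopD 0) q ω) ∈ fallSet k j}
  have hE : ∀ k j n, P (E k j n) ≤ ratLaw X P (fallSet k j) := fun k j n => by
    have hA : MeasurableSet[(hτ n).measurableSpace] {ω | τ n ω ≠ ⊤} :=
      (hτ n).measurable (measurableSet_singleton ⊤).compl
    have h := congrArg (fun μ => μ (fallSet k j))
      (hX.map_restart_stoppingTime (hτ n) hA fun ω hω => hω)
    have hm := hX.measurable_restart_time ((hτ n).measurable'.untopD 0)
    rw [Measure.map_apply hm (measurableSet_fallSet k j),
      Measure.restrict_apply (hm (measurableSet_fallSet k j)), Measure.smul_apply,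
      smul_eq_mul] at h
    calc P (E k j n) = P {ω | τ n ω ≠ ⊤} * ratLaw X P (fallSet k j) := by
          rw [Set.inter_comm] at h
          exact h
      _ ≤ 1 * ratLaw X P (fallSet k j) := by gcongr; exact prob_le_one
      _ = _ := one_mul _
  have hB : ∀ k, P {ω | ∀ j, ∀ᶠ n in atTop, ω ∈ E k j n} = 0 := fun k => by
    refine le_antisymm (ge_of_tendsto' (hX.tendsto_ratLaw_fallSet k) fun j => ?_) zero_le
    have hsub : {ω | ∀ j, ∀ᶠ n in atTop, ω ∈ E k j n} ⊆ ⋃ N, ⋂ n ≥ N, E k j n := fun ω hω => by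
      obtain ⟨N, hN⟩ := eventually_atTop.1 (hω j)
      exact Set.mem_iUnion.2 ⟨N, Set.mem_iInter₂.2 hN⟩
    refine (measure_mono hsub).trans ?_
    rw [Monotone.measure_iUnion]
    · exact iSup_le fun N => (measure_mono (Set.iInter₂_subset N le_rfl)).trans (hE k j N)
    · exact fun M N hMN => Set.biInter_mono (fun n hn => hMN.trans hn) fun _ _ => le_rfl
  refine measure_mono_null (fun ω hω => ?_) (measure_iUnion_null hB)
  exact Set.mem_iUnion.2 (exists_eventually_restart_lt (hX.regular ω) (hY ω) (hjump ω) hω)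

lemma passageUp_self_ae_eq (c : ℝ) : passageUp X c =ᵐ[P] passageUp (runSup X) c := by
  refine hX.passageUp_ae_eq hX.regular (fun s t => hX.measurable_filtration)
    (fun ω t ht l m hl hm => ?_) c
  have : (𝓝[<] t).NeBot := nhdsLT_neBot_of_exists_lt ⟨0, ht⟩
  rw [tendsto_nhds_unique hl hm]

lemma tauU_ae_eq (z b : ℝ) : tauU X z b =ᵐ[P] passageUp (runSup (drawup X z)) b := by
  refine hX.passageUp_ae_eq (fun ω => drawup_regular (hX.regular ω) z)
    (fun s t => hX.measurable_drawup z) (fun ω t ht l m hl hm => ?_) b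
  have : (𝓝[<] t).NeBot := nhdsLT_neBot_of_exists_lt ⟨0, ht⟩
  obtain ⟨l', hl', hle⟩ := (hX.regular ω).leftLim t ht
  rw [tendsto_nhds_unique hl' hl] at hle
  obtain ⟨m', hm', -, h⟩ := drawup_leftLim (hX.regular ω) (z := z) ht hl hle
  rwa [tendsto_nhds_unique hm hm']

end IsRegularLevy

end QuasiLeftContinuity

section RestartedDrawup

variable {Ω : Type*} {X Y : ℝ≥0 → Ω → ℝ} {ω : Ω} {s t : ℝ≥0} {a b c r y z : ℝ}

/-! ### The discount factor -/

lemma discount_coe (r : ℝ) (t : ℝ≥0) : discount r t = Real.exp (-r * t) := rfl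

lemma discount_top (r : ℝ) : discount r ⊤ = 0 := rfl

lemma discount_nonneg (r : ℝ) (τ : WithTop ℝ≥0) : 0 ≤ discount r τ := by
  cases τ with
  | top => exact le_rfl
  | coe t => exact (Real.exp_pos _).le

lemma discount_le_one (hr : 0 ≤ r) (τ : WithTop ℝ≥0) : discount r τ ≤ 1 := by
  cases τ with
  | top => exact zero_le_one
  | coe t => exact Real.exp_le_one_iff.2 (by nlinarith [t.2, mul_nonneg hr t.2])

lemma discount_coe_add (r : ℝ) (t : ℝ≥0) (τ : WithTop ℝ≥0) :
    discount r (t + τ) = discount r t * discount r τ := by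
  cases τ with
  | top => rw [WithTop.add_top, discount_top, mul_zero]
  | coe s =>
    rw [← WithTop.coe_add, discount_coe, discount_coe, discount_coe, ← Real.exp_add]
    push_cast
    ring_nf

lemma measurable_discount (r : ℝ) : Measurable (discount r) :=
  WithTop.measurable_of_measurable_comp_coe (by simp only [discount_coe]; fun_prop)

section DiscExp

variable [MeasurableSpace Ω] {P : Measure Ω} {τ τ' τ₁ τ₂ : Ω → WithTop ℝ≥0} {A A' A₁ A₂ : Set Ω}

/-- A discounted expectation depends on the time and on the event only through the events that
the time takes a given finite value. -/
lemma discExp_congr_ae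
    (h : ∀ᵐ ω ∂P, ∀ t : ℝ≥0, (τ ω = t ∧ ω ∈ A) ↔ (τ' ω = t ∧ ω ∈ A')) :
    discExp P r τ A = discExp P r τ' A' := by
  classical
  refine integral_congr_ae (h.mono fun ω hω => ?_)
  simp only [Set.indicator_apply]
  cases h1 : τ ω with
  | top =>
    cases h2 : τ' ω with
    | top => simp [discount_top]
    | coe s =>
      have := (hω s).not.1 fun h => WithTop.top_ne_coe (h1.symm.trans h.1)
      rw [if_neg fun h => this ⟨h2, h⟩, discount_top, ite_self]
  | coe t =>
    by_cases hA : ω ∈ A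
    · obtain ⟨h2, h3⟩ := (hω t).1 ⟨h1, hA⟩
      rw [if_pos hA, if_pos h3, h2]
    · rw [if_neg hA]
      cases h2 : τ' ω with
      | top => simp [discount_top]
      | coe s =>
        rw [if_neg fun h => hA ((hω s).2 ⟨h2, h⟩).2]

lemma integrable_discount_indicator [IsFiniteMeasure P] (hr : 0 ≤ r) (hτ : AEMeasurable τ P)
    (hA : NullMeasurableSet A P) :
    Integrable (fun ω => A.indicator (fun ω => discount r (τ ω)) ω) P := by
  refine (Integrable.of_bound ((measurable_discount r).comp_aemeasurable hτ).aestronglyMeasurable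
    1 (.of_forall fun ω => ?_)).indicator₀ hA
  simp only [Function.comp]
  rw [Real.norm_of_nonneg (discount_nonneg _ _)]
  exact discount_le_one hr _

lemma discExp_eq_add
    (h₁ : Integrable (fun ω => A₁.indicator (fun ω => discount r (τ₁ ω)) ω) P)
    (h₂ : Integrable (fun ω => A₂.indicator (fun ω => discount r (τ₂ ω)) ω) P)
    (h : ∀ ω, ∀ t : ℝ≥0, (τ ω = t ∧ ω ∈ A) ↔ (τ₁ ω = t ∧ ω ∈ A₁) ∨ (τ₂ ω = t ∧ ω ∈ A₂))
    (hd : ∀ ω, ∀ t : ℝ≥0, τ₁ ω = t → ω ∈ A₁ → τ₂ ω = t → ω ∉ A₂) :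
    discExp P r τ A = discExp P r τ₁ A₁ + discExp P r τ₂ A₂ := by
  classical
  rw [discExp, discExp, discExp, ← integral_add h₁ h₂]
  refine integral_congr_ae (.of_forall fun ω => ?_)
  have key : ∀ (σ : Ω → WithTop ℝ≥0) (B : Set Ω), B.indicator (fun ω => discount r (σ ω)) ω = 0 ∨
      ∃ t : ℝ≥0, (σ ω = t ∧ ω ∈ B) ∧
        B.indicator (fun ω => discount r (σ ω)) ω = discount r t := fun σ B => by
    by_cases hB : ω ∈ B
    · rw [Set.indicator_of_mem hB]
      cases hσ : σ ω with
      | top => exact .inl rfl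
      | coe t => exact .inr ⟨t, ⟨rfl, hB⟩, rfl⟩
    · exact .inl (Set.indicator_of_notMem hB _)
  have val : ∀ (σ : Ω → WithTop ℝ≥0) (B : Set Ω) (t : ℝ≥0), σ ω = t ∧ ω ∈ B →
      B.indicator (fun ω => discount r (σ ω)) ω = discount r t := fun σ B t ⟨h1, h2⟩ => by
    rw [Set.indicator_of_mem h2, h1]
  simp only
  rcases key τ₁ A₁ with h1 | ⟨t, ht, h1⟩
  · rcases key τ₂ A₂ with h2 | ⟨t, ht, h2⟩
    · rcases key τ A with h0 | ⟨t, ht, h0⟩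
      · rw [h0, h1, h2, add_zero]
      · have hpos := Real.exp_pos (-r * t)
        rw [← discount_coe] at hpos
        rcases (h ω t).1 ht with h' | h'
        · exact absurd (val _ _ _ h') (by rw [h1]; exact hpos.ne)
        · exact absurd (val _ _ _ h') (by rw [h2]; exact hpos.ne)
    · rw [val _ _ _ ((h ω t).2 (.inr ht)), h1, h2, zero_add]
  · have h2 : A₂.indicator (fun ω => discount r (τ₂ ω)) ω = 0 := by
      rcases key τ₂ A₂ with h2 | ⟨t', ht', -⟩
      · exact h2
      · have e1 := ((h ω t).2 (.inl ht)).1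
        have e2 := ((h ω t').2 (.inr ht')).1
        rw [e1] at e2
        obtain rfl := WithTop.coe_injective e2
        exact absurd ht'.2 (hd ω t ht.1 ht.2 ht'.1)
    rw [val _ _ _ ((h ω t).2 (.inl ht)), h1, h2, add_zero]

end DiscExp

/-! ### The drawup time as a functional of the path at rational times -/

/-- The path `w` has drawups arbitrarily close to `b` before the time `q`. -/
def RatDrawup (b : ℝ) (q : ℚ≥0) (w : ℚ≥0 → ℝ) : Prop :=
  ∀ n : ℕ, ∃ u v : ℚ≥0, u ≤ v ∧ v ≤ q ∧ b - 1 / (n + 1) < w v - w u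

open Classical in
/-- The infimum of the rational times before which a path has drawups arbitrarily close
to `b`. -/
noncomputable def ratTime (b : ℝ) (w : ℚ≥0 → ℝ) : WithTop ℝ≥0 :=
  ⨅ q : ℚ≥0, if RatDrawup b q w then ((q : ℝ≥0) : WithTop ℝ≥0) else ⊤

lemma measurable_ratTime (b : ℝ) : Measurable (ratTime b) := by
  refine Measurable.iInf fun q => Measurable.ite ?_ measurable_const measurable_const
  have : {w | RatDrawup b q w} = ⋂ n : ℕ, ⋃ (u : ℚ≥0) (v : ℚ≥0) (_ : u ≤ v) (_ : v ≤ q),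
      {w : ℚ≥0 → ℝ | b - 1 / (n + 1) < w v - w u} := by
    ext w
    simp only [RatDrawup, Set.mem_ofPred_eq, Set.mem_iInter, Set.mem_iUnion, exists_prop]
  rw [this]
  exact .iInter fun n => .iUnion fun u => .iUnion fun v => .iUnion fun _ => .iUnion fun _ =>
    measurableSet_lt measurable_const ((measurable_pi_apply v).sub (measurable_pi_apply u))

lemma drawup_zero_eq (hX : IsRegularPath fun t => X t ω) (h0 : X 0 ω = 0) (t : ℝ≥0) :
    drawup X 0 t ω = X t ω - runInf X t ω := by
  rw [drawup, neg_zero, min_eq_left (h0 ▸ runInf_le hX zero_le)]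

lemma ratDrawup_iff (hX : IsRegularPath fun t => X t ω) (h0 : X 0 ω = 0) (hb : 0 < b) (q : ℚ≥0) :
    RatDrawup b q (fun q => X q ω) ↔ b ≤ runSup (drawup X 0) q ω := by
  have hU := drawup_regular hX 0
  constructor
  · intro h
    refine le_of_forall_pos_lt_add fun ε hε => ?_
    obtain ⟨n, hn⟩ := exists_nat_one_div_lt hε
    obtain ⟨u, v, huv, hvq, h⟩ := h n
    have h1 : drawup X 0 v ω ≤ runSup (drawup X 0) q ω := hU.le_runSup (by exact_mod_cast hvq)
    have h2 : runInf X v ω ≤ X u ω := runInf_le hX (by exact_mod_cast huv)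
    rw [drawup_zero_eq hX h0] at h1
    linarith
  · intro h n
    set d := max (b - 1 / ((n : ℝ) + 1)) 0
    have hd : d < runSup (drawup X 0) q ω := by
      have : (0 : ℝ) < 1 / (n + 1) := by positivity
      exact (max_lt (by linarith) hb).trans_le h
    obtain ⟨v, hv, h1⟩ := (lt_runSup_iff (hU.bddAbove q)).1 hd
    obtain ⟨u, hu, h2⟩ := exists_eq_runInf hX v
    rw [drawup_zero_eq hX h0, ← h2] at h1
    obtain ⟨v', hvv', hv'q, h3⟩ := exists_rat_le_of_lt (hX.rightCont v)
      (show d + X u ω < X v ω by linarith) hv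
    obtain ⟨u', huu', hu'v', h4⟩ := exists_rat_le_of_lt ((hX.rightCont u).neg)
      (show d - X v' ω < - X u ω by linarith) (hu.trans hvv')
    refine ⟨u', v', hu'v', hv'q, (le_max_left _ _).trans_lt (?_ : d < _)⟩
    have : d - X v' ω < - X u' ω := h4
    linarith

lemma passageUp_eq_ratTime (hX : IsRegularPath fun t => X t ω) (h0 : X 0 ω = 0) (hb : 0 < b) :
    passageUp (runSup (drawup X 0)) b ω = ratTime b (fun q => X q ω) := by
  have hU := drawup_regular hX 0
  refine le_antisymm (le_iInf fun q => ?_) ?_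
  · split_ifs with h
    · exact (passageUp_runSup_le_iff hU).2 ((ratDrawup_iff hX h0 hb q).1 h)
    · exact le_top
  · by_contra! hlt
    obtain ⟨u, hu⟩ := WithTop.ne_top_iff_exists.1 hlt.ne_top
    obtain ⟨v, huv, hv⟩ : ∃ v : ℝ≥0, u < v ∧ (v : WithTop ℝ≥0) ≤ ratTime b (fun q => X q ω) := by
      rw [← hu] at hlt
      cases h : ratTime b (fun q => X q ω) with
      | top => exact ⟨u + 1, lt_add_one u, le_top⟩
      | coe v =>
        rw [h] at hlt
        exact ⟨v, by exact_mod_cast hlt, le_rfl⟩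
    obtain ⟨q, hq1, hq2⟩ := exists_nnrat_btwn huv
    have hq : RatDrawup b q fun q => X q ω := (ratDrawup_iff hX h0 hb q).2
      (((passageUp_runSup_le_iff hU).1 hu.symm.le).trans (runSup_mono hU.bddAbove hq1.le))
    have : ratTime b (fun q => X q ω) ≤ (q : ℝ≥0) := (iInf_le _ q).trans (by rw [if_pos hq])
    have : v ≤ q := by exact_mod_cast hv.trans this
    exact this.not_gt hq2

/-- At a time at which the process is at its running minimum and the drawup has not reached
`b`, the time to wait for the latter is the drawup time of the restarted process. -/
lemma passageUp_eq_add (hX : IsRegularPath fun t => X t ω) (h1 : X t ω = runInf X t ω)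
    (h2 : X t ω ≤ -z) (hlt : t < passageUp (runSup (drawup X z)) b ω) :
    passageUp (runSup (drawup X z)) b ω =
      t + passageUp (runSup (drawup (restart X t) 0)) b ω := by
  have hU := drawup_regular hX z
  have hU' := drawup_regular (restart_regular hX t) 0
  have hlt' : runSup (drawup X z) t ω < b := by
    rwa [← not_le, passageUp_runSup_le_iff hU, not_le] at hlt
  have key : ∀ u : ℝ≥0, passageUp (runSup (drawup X z)) b ω ≤ (t + u : ℝ≥0) ↔
      passageUp (runSup (drawup (restart X t) 0)) b ω ≤ u := fun u => by
    rw [passageUp_runSup_le_iff hU, passageUp_runSup_le_iff hU']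
    constructor
    · intro h
      have : runSup (drawup X z) (t + u) ω ≤
          max (runSup (drawup X z) t ω) (runSup (drawup (restart X t) 0) u ω) :=
        runSup_le fun s hs => by
          rcases le_total s t with hst | hst
          · exact le_max_of_le_left (hU.le_runSup hst)
          · obtain ⟨v, rfl⟩ := exists_add_of_le hst
            rw [drawup_add hX h1 h2]
            exact le_max_of_le_right (hU'.le_runSup (le_of_add_le_add_left hs))
      exact (le_max_iff.1 (h.trans this)).resolve_left hlt'.not_ge
    · refine fun h => h.trans (runSup_le fun s hs => ?_)
      rw [← drawup_add hX h1 h2]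
      exact hU.le_runSup (add_le_add_right hs t)
  have hge : ∀ u : ℝ≥0, passageUp (runSup (drawup X z)) b ω = u → ∃ v, u = t + v := fun u hu => by
    rw [hu] at hlt
    exact exists_add_of_le (by exact_mod_cast hlt.le)
  refine le_antisymm ?_ ?_
  · cases h : passageUp (runSup (drawup (restart X t) 0)) b ω with
    | top => exact le_top.trans_eq (WithTop.add_top _).symm
    | coe u => exact_mod_cast (key u).2 h.le
  · cases h : passageUp (runSup (drawup X z)) b ω with
    | top => exact le_top
    | coe u =>
      obtain ⟨v, rfl⟩ := hge u h
      push_cast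
      gcongr
      exact (key v).1 h.le

/-! ### Regeneration of the drawup process -/

namespace IsRegularLevy

variable [MeasurableSpace Ω] {P : Measure Ω} [IsProbabilityMeasure P] (hX : IsRegularLevy X P)
include hX

/-- Strong Markov property, for the integral of a product of a function of a stopping time and
a function of the restarted path. -/
lemma setIntegral_mul_restart {τ : Ω → WithTop ℝ≥0} (hτ : IsStoppingTime hX.filtration τ)
    {C : Set Ω} (hC : MeasurableSet[hτ.measurableSpace] C) (hCτ : ∀ ω ∈ C, τ ω ≠ ⊤)
    {f : WithTop ℝ≥0 → ℝ} (hf : Measurable f) {g : (ℚ≥0 → ℝ) → ℝ} (hg : Measurable g) :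
    ∫ ω in C, f (τ ω) * g (fun q => restart X ((τ ω).untopD 0) q ω) ∂P =
      (∫ ω in C, f (τ ω) ∂P) * ∫ ω, g (fun q => X q ω) ∂P := by
  have := hX.isProbabilityMeasure_ratLaw
  have hm := hX.measurable_restart_time (hτ.measurable'.untopD 0)
  have hprod : ((P.restrict C).map τ).prod (ratLaw X P) = (P.restrict C).map
      fun ω => (τ ω, fun q : ℚ≥0 => restart X ((τ ω).untopD 0) q ω) := by
    refine Measure.prod_eq fun s B hs hB => ?_
    have hA : MeasurableSet[hτ.measurableSpace] (τ ⁻¹' s ∩ C) := (hτ.measurable hs).inter hC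
    have h := congrArg (fun μ => μ B)
      (hX.map_restart_stoppingTime hτ hA fun ω hω => hCτ ω hω.2)
    rw [Measure.map_apply hm hB, Measure.restrict_apply (hm hB), Measure.smul_apply,
      smul_eq_mul] at h
    rw [Measure.map_apply (hτ.measurable'.prodMk hm) (hs.prod hB),
      Measure.map_apply hτ.measurable' hs, Measure.restrict_apply (hτ.measurable' hs), ← h,
      Measure.restrict_apply ((hτ.measurable'.prodMk hm) (hs.prod hB))]
    congr 1
    ext ω
    simp only [Set.mem_inter_iff, Set.mem_preimage, Set.mem_prod]
    tauto
  have e1 := integral_map (μ := P.restrict C) (hτ.measurable'.prodMk hm).aemeasurable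
    (f := fun p => f p.1 * g p.2)
    ((hf.comp measurable_fst).mul (hg.comp measurable_snd)).aestronglyMeasurable
  rw [← hprod, integral_prod_mul, integral_map hτ.measurable'.aemeasurable
    hf.aestronglyMeasurable, ratLaw, integral_map hX.measurable_ratPath.aemeasurable
    hg.aestronglyMeasurable] at e1
  exact e1.symm

lemma aemeasurable_tauU (z b : ℝ) : AEMeasurable (tauU X z b) P :=
  ⟨_, (hX.isStoppingTime_passageUp_runSup (fun ω => drawup_regular (hX.regular ω) z)
    (fun _ _ => hX.measurable_drawup z) b).measurable', hX.tauU_ae_eq z b⟩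

lemma aemeasurable_passageUp (c : ℝ) : AEMeasurable (passageUp X c) P :=
  ⟨_, (hX.isStoppingTime_passageUp_runSup hX.regular
    (fun _ _ => hX.measurable_filtration) c).measurable', hX.passageUp_self_ae_eq c⟩

/-- The drawup process starts afresh from `0` at the time `tauR X y z a`, if this comes before
the drawup time. -/
lemma discExp_tauU_eq_mul (hb : 0 < b) (hab : b < a) (hy : 0 ≤ y) (hz : 0 ≤ z)
    (hyz : y + z < a) :
    discExp P r (tauU X z b) {ω | tauR X y z a ω < tauU X z b ω} =
      discExp P r (tauR X y z a) {ω | tauR X y z a ω < tauU X z b ω} *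
        discExp P r (tauU X 0 b) Set.univ := by
  set σ := passageUp (runSup (drawup X z)) b
  have hσ : IsStoppingTime hX.filtration σ :=
    hX.isStoppingTime_passageUp_runSup (fun ω => drawup_regular (hX.regular ω) z)
      (fun _ _ => hX.measurable_drawup z) b
  have hρ := hX.isStoppingTime_tauR y z a
  have h1 : discExp P r (tauU X z b) {ω | tauR X y z a ω < tauU X z b ω} =
      discExp P r σ {ω | tauR X y z a ω < σ ω} := discExp_congr_ae <| by
    filter_upwards [hX.tauU_ae_eq z b] with ω hω t
    simp only [hω, σ]
  have h2 : discExp P r (tauR X y z a) {ω | tauR X y z a ω < tauU X z b ω} =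
      discExp P r (tauR X y z a) {ω | tauR X y z a ω < σ ω} := discExp_congr_ae <| by
    filter_upwards [hX.tauU_ae_eq z b] with ω hω t
    simp only [hω, σ]
  have h3 : discExp P r (tauU X 0 b) Set.univ =
      ∫ ω, discount r (ratTime b fun q => X q ω) ∂P := by
    rw [discExp]
    refine integral_congr_ae ?_
    filter_upwards [hX.tauU_ae_eq 0 b] with ω hω
    rw [Set.indicator_univ, hω, passageUp_eq_ratTime (hX.regular ω) (hX.zero ω) hb]
  have hC : MeasurableSet[hρ.measurableSpace] {ω | tauR X y z a ω < σ ω} := by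
    have := (IsStoppingTime.measurableSet_stopping_time_le hσ hρ).compl
    convert this using 1
    ext ω
    simp
  have hC' : MeasurableSet {ω | tauR X y z a ω < σ ω} := hρ.measurableSpace_le _ hC
  rw [h1, h2, h3, discExp, discExp, integral_indicator hC', integral_indicator hC',
    ← hX.setIntegral_mul_restart hρ hC (fun ω hω => (show tauR X y z a ω < σ ω from hω).ne_top)
      (measurable_discount r) (g := fun w => discount r (ratTime b w))
      ((measurable_discount r).comp (measurable_ratTime b))]
  refine setIntegral_congr_fun hC' fun ω hω => ?_
  obtain ⟨t, ht⟩ := WithTop.ne_top_iff_exists.1 (show tauR X y z a ω < σ ω from hω).ne_top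
  simp only [Set.mem_ofPred_eq, ← ht] at hω
  have hU : ∀ s < t, drawup X z s ω < b := fun s hs => by
    have := hω.trans_le (passageUp_runSup_le (drawup_regular (hX.regular ω) z))
    exact (lt_passageUp_iff (drawup_regular (hX.regular ω) z).rightCont).1 this s hs.le
  obtain ⟨hR, hR'⟩ := (passageUp_eq_iff (rangeProc_rightCont (hX.regular ω) y z)).1 ht.symm
  obtain ⟨k1, k2⟩ := eq_runInf_of_rangeProc (hX.regular ω) (hX.zero ω) hab hy hz hyz hR hR' hU
  simp only [← ht, WithTop.untopD_coe]
  have h0 : restart X t 0 ω = 0 := by simp [restart]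
  rw [← discount_coe_add, ← passageUp_eq_ratTime (restart_regular (hX.regular ω) t) h0 hb,
    ← passageUp_eq_add (hX.regular ω) k1 k2 hω]

end IsRegularLevy

end RestartedDrawup

section Formulas

variable {Ω : Type*} [MeasurableSpace Ω] {P : Measure Ω} [IsProbabilityMeasure P]
  {X X' : ℝ≥0 → Ω → ℝ} {a b r y z : ℝ}

/-! ### Drawups occur with positive probability -/

namespace IsRegularLevy

variable (hX : IsRegularLevy X P)
include hX

omit [IsProbabilityMeasure P] in
/-- If all increments were almost surely nonpositive, right-continuity would make almost all paths
antitone. -/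
lemma exists_measure_pos (hna : ¬ ∀ᵐ ω ∂P, Antitone fun t => X t ω) :
    ∃ h : ℝ≥0, P {ω | 0 < X h ω} ≠ 0 := by
  by_contra! hcon
  refine hna ?_
  have hle : ∀ s d : ℝ≥0, ∀ᵐ ω ∂P, X (s + d) ω - X s ω ≤ 0 := fun s d => by
    refine (hX.stationary s d).symm.ae_snd (p := fun x => x ≤ 0) measurableSet_Iic ?_
    exact measure_mono_null (fun ω (hω : ¬ X d ω ≤ 0) => not_le.1 hω) (hcon d)
  have hall : ∀ᵐ ω ∂P, ∀ s d : ℚ≥0, X (s + d) ω - X s ω ≤ 0 :=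
    ae_all_iff.2 fun s => ae_all_iff.2 fun d => hle s d
  filter_upwards [hall] with ω hω u v huv
  by_contra! hlt
  obtain ⟨v', hv1, -, hv2⟩ := exists_rat_lt_of_lt ((hX.regular ω).rightCont v) hlt (lt_add_one v)
  obtain ⟨u', -, hu1, hu2⟩ := exists_rat_le_of_lt (((hX.regular ω).rightCont u).neg)
    (neg_lt_neg hv2) (huv.trans hv1)
  obtain ⟨d, rfl⟩ := exists_add_of_le hu1
  have h1 := hω u' d
  have h2 : - X (u' + d : ℚ≥0) ω < - X u' ω := hu2
  push_cast at h2
  linarith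

lemma measure_mul_le_ne_zero {h : ℝ≥0} {ε : ℝ} (hε : P {ω | ε ≤ X h ω} ≠ 0) (k : ℕ) :
    P {ω | k * ε ≤ X (k * h) ω} ≠ 0 := by
  induction k with
  | zero => simp [hX.zero]
  | succ k ih =>
    have hle : (k : ℝ≥0) * h ≤ (k + 1 : ℕ) * h := by gcongr; simp
    have hind := hX.indep.indepFun_eval_sub (zero_le (a := (k : ℝ≥0) * h)) hle
      (.of_forall hX.zero)
    have hst := (hX.stationary (k * h) h).measure_mem_eq (s := Set.Ici ε) measurableSet_Ici
    have heq : (k : ℝ≥0) * h + h = (k + 1 : ℕ) * h := by push_cast; ring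
    rw [heq] at hst
    have := hind.measure_inter_preimage_eq_mul (Set.Ici (k * ε)) (Set.Ici ε) measurableSet_Ici
      measurableSet_Ici
    refine fun h0 => mul_ne_zero ih hε (nonpos_iff_eq_zero.1 ?_)
    calc P {ω | k * ε ≤ X (k * h) ω} * P {ω | ε ≤ X h ω}
        = P (X (k * h) ⁻¹' Set.Ici (k * ε) ∩
          (X ((k + 1 : ℕ) * h) - X (k * h)) ⁻¹' Set.Ici ε) := by rw [this]; congr 1; exact hst.symm
      _ ≤ P {ω | (k + 1 : ℕ) * ε ≤ X ((k + 1 : ℕ) * h) ω} := by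
          refine measure_mono fun ω ⟨h1, h2⟩ => ?_
          simp only [Set.mem_preimage, Set.mem_Ici, Pi.sub_apply, Set.mem_ofPred_eq] at *
          push_cast at *
          linarith
      _ = 0 := h0

/-- The denominator of the formula for `nu` does not vanish: consecutive increments exceeding a
small `ε` produce a drawup of size `b`. -/
lemma discExp_tauU_pos (hna : ¬ ∀ᵐ ω ∂P, Antitone fun t => X t ω) (hr : 0 ≤ r) (b : ℝ) :
    0 < discExp P r (tauU X 0 b) Set.univ := by
  obtain ⟨h, hh⟩ := hX.exists_measure_pos hna
  obtain ⟨n, hn⟩ : ∃ n : ℕ, P {ω | 1 / ((n : ℝ) + 1) ≤ X h ω} ≠ 0 := by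
    by_contra! hcon
    refine hh (measure_mono_null (fun ω hω => ?_) (measure_iUnion_null hcon))
    obtain ⟨n, hn⟩ := exists_nat_one_div_lt (show 0 < X h ω from hω)
    exact Set.mem_iUnion.2 ⟨n, hn.le⟩
  obtain ⟨k, hk⟩ := exists_nat_gt (b * (n + 1))
  have hkb : b ≤ k * (1 / ((n : ℝ) + 1)) := by
    rw [mul_one_div, le_div_iff₀ (by positivity)]
    exact hk.le
  rw [discExp, integral_pos_iff_support_of_nonneg]
  · refine pos_iff_ne_zero.2 fun h0 => hX.measure_mul_le_ne_zero hn k (measure_mono_null ?_ h0)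
    intro ω hω
    have hU : b ≤ drawup X 0 (k * h) ω := by
      have := runInf_le (hX.regular ω) (zero_le (a := (k : ℝ≥0) * h))
      rw [hX.zero] at this
      rw [drawup_zero_eq (hX.regular ω) (hX.zero ω)]
      have hω' : k * (1 / ((n : ℝ) + 1)) ≤ X (k * h) ω := hω
      linarith
    have hle : tauU X 0 b ω ≤ (k * h : ℝ≥0) :=
      (passageUp_le_iff (drawup_regular (hX.regular ω) 0).rightCont).2 ⟨_, le_rfl, hU⟩
    obtain ⟨t, ht⟩ := WithTop.ne_top_iff_exists.1 (ne_top_of_le_ne_top WithTop.coe_ne_top hle)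
    rw [Set.indicator_univ, Function.mem_support, ← ht]
    exact (Real.exp_pos _).ne'
  · exact fun ω => Set.indicator_nonneg (fun _ _ => discount_nonneg _ _) _
  · exact integrable_discount_indicator hr (hX.aemeasurable_tauU 0 b) .univ

end IsRegularLevy

/-! ### The two formulas for processes with regular paths -/

omit [MeasurableSpace Ω] in
lemma supAt_of_eq {τ : Ω → WithTop ℝ≥0} {ω : Ω} {t : ℝ≥0} (h : τ ω = t) :
    supAt X τ ω = runSup X t ω := by
  rw [supAt, stoppedValue, h]
  rfl

omit [MeasurableSpace Ω] in
lemma infAt_of_eq {τ : Ω → WithTop ℝ≥0} {ω : Ω} {t : ℝ≥0} (h : τ ω = t) :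
    infAt X τ ω = runInf X t ω := by
  rw [infAt, stoppedValue, h]
  rfl

namespace IsRegularLevy

variable (hX : IsRegularLevy X P)
include hX

omit [IsProbabilityMeasure P] in
lemma nu_eq_of_le_add (hab : b < a) (hy : 0 ≤ y) (hne : y < a ∨ z < b) (hyz : a ≤ y + z) :
    nu X P r a b y z = discExp P r (passageDown X (y - a))
      {ω | passageDown X (y - a) ω < passageUp X (b - z) ω} := by
  refine discExp_congr_ae (.of_forall fun ω t => ?_)
  have := tauD_eq_iff_of_le_add (t := t) (hX.regular ω) (hX.zero ω) hab hyz hne hy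
  simp only [Set.mem_ofPred_eq]
  constructor
  · rintro ⟨h1, h2⟩
    obtain ⟨h3, h4⟩ := this.1 ⟨h1, h1 ▸ h2⟩
    exact ⟨h3, h3.symm ▸ h4⟩
  · rintro ⟨h1, h2⟩
    obtain ⟨h3, h4⟩ := this.2 ⟨h1, h1 ▸ h2⟩
    exact ⟨h3, h3.symm ▸ h4⟩

/-- The formula for `nu` when `y + z < a`: a drawdown occurring first is followed by a drawup that
starts from `0` and is independent of the past. -/
lemma nu_mul_of_add_lt (hb : 0 < b) (hab : b < a) (hy : 0 ≤ y) (hz : 0 ≤ z) (hyz : y + z < a) :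
    nu X P r a b y z * discExp P r (tauU X 0 b) Set.univ = discExp P r (tauU X z b)
      {ω | a ≤ max (supAt X (tauU X z b) ω) y - infAt X (tauU X z b) ω ∧
        infAt X (tauU X z b) ω ≤ -z ∧ supAt X (tauU X z b) ω ≤ b - z} := by
  have h1 : nu X P r a b y z =
      discExp P r (tauR X y z a) {ω | tauR X y z a ω < tauU X z b ω} := by
    refine discExp_congr_ae (.of_forall fun ω t => ?_)
    have := tauD_eq_and_le_tauU_iff (t := t) (hX.regular ω) (hX.zero ω) hb hab hy hz hyz
    simp only [Set.mem_ofPred_eq]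
    constructor
    · rintro ⟨h1, h2⟩
      obtain ⟨h3, h4⟩ := this.1 ⟨h1, h1 ▸ h2⟩
      exact ⟨h3, h3.symm ▸ h4⟩
    · rintro ⟨h1, h2⟩
      obtain ⟨h3, h4⟩ := this.2 ⟨h1, h1 ▸ h2⟩
      exact ⟨h3, h3.symm ▸ h4⟩
  rw [h1, ← hX.discExp_tauU_eq_mul hb hab hy hz hyz]
  refine discExp_congr_ae (.of_forall fun ω t => ?_)
  have := tauU_eq_and_range_iff (t := t) (hX.regular ω) (hX.zero ω) hb hab hy hz hyz
  simp only [Set.mem_ofPred_eq]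
  constructor
  · rintro ⟨h1, h2⟩
    rw [supAt_of_eq h1, infAt_of_eq h1]
    exact ⟨h1, (this.2 ⟨h1, h1 ▸ h2⟩).2⟩
  · rintro ⟨h1, h2⟩
    rw [supAt_of_eq h1, infAt_of_eq h1] at h2
    exact ⟨h1, h1.symm ▸ (this.1 ⟨h1, h2⟩).2⟩

lemma lam_eq_add (hr : 0 ≤ r) (hab : b < a) (hy : 0 ≤ y) (hz : 0 ≤ z) :
    lam X P r a b y z = discExp P r (passageUp X (b - z))
        {ω | passageUp X (b - z) ω < passageDown X (max (y - a) (-z)) ω} +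
      discExp P r (tauU X z b)
        {ω | max (supAt X (tauU X z b) ω) y - infAt X (tauU X z b) ω < a ∧
          infAt X (tauU X z b) ω ≤ -z} := by
  have hdown : ∀ c, Measurable (passageDown X c) := fun c =>
    (hX.isStoppingTime_passageDown c).measurable'
  have hdown_iff : ∀ ω (t : ℝ≥0), passageDown X (-z) ω ≤ t ↔ runInf X t ω ≤ -z := fun ω t => by
    obtain ⟨s, hs, h⟩ := exists_eq_runInf (hX.regular ω) t
    rw [passageDown_le_iff (hX.regular ω).rightCont]
    exact ⟨fun ⟨u, hu, h'⟩ => (runInf_le (hX.regular ω) hu).trans h', fun h' => ⟨s, hs, h ▸ h'⟩⟩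
  have hevent : ∀ ω (t : ℝ≥0), tauU X z b ω = t → ((tauU X z b ω < tauR X y z a ω ∧
      passageDown X (-z) ω ≤ tauU X z b ω) ↔
        max (runSup X t ω) y - runInf X t ω < a ∧ runInf X t ω ≤ -z) := fun ω t h => by
    rw [h, hdown_iff]
    refine and_congr_left fun hI => ?_
    have hR : rangeProc X y z t ω = max (runSup X t ω) y - runInf X t ω := by
      rw [rangeProc, min_eq_left hI]
    rw [← hR, tauR, lt_passageUp_iff (rangeProc_rightCont (hX.regular ω) y z)]
    exact ⟨fun h => h t le_rfl, fun h s hs => (rangeProc_mono (hX.regular ω) y z hs).trans_lt h⟩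
  -- The second event is rewritten in terms of passage times, to make its measurability plain.
  have hset : discExp P r (tauU X z b)
        {ω | max (supAt X (tauU X z b) ω) y - infAt X (tauU X z b) ω < a ∧
          infAt X (tauU X z b) ω ≤ -z} =
      discExp P r (tauU X z b) {ω | tauU X z b ω < tauR X y z a ω ∧
        passageDown X (-z) ω ≤ tauU X z b ω} := by
    refine discExp_congr_ae (.of_forall fun ω t => and_congr_right fun h => ?_)
    rw [Set.mem_ofPred_eq, Set.mem_ofPred_eq, hevent ω t h, supAt_of_eq h, infAt_of_eq h]
  rw [hset]
  refine discExp_eq_add ?_ ?_ (fun ω t => ?_) (fun ω t h1 h2 h3 h4 => ?_)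
  · exact integrable_discount_indicator hr (hX.aemeasurable_passageUp _)
      (nullMeasurableSet_lt (hX.aemeasurable_passageUp _) (hdown _).aemeasurable)
  · refine integrable_discount_indicator hr (hX.aemeasurable_tauU z b) (.inter ?_ ?_)
    · exact nullMeasurableSet_lt (hX.aemeasurable_tauU z b)
        (hX.isStoppingTime_tauR y z a).measurable'.aemeasurable
    · exact nullMeasurableSet_le (hdown _).aemeasurable (hX.aemeasurable_tauU z b)
  · have k1 := tauU_eq_iff_of_lt_runInf (t := t) (z := z) (hX.regular ω) (hX.zero ω) hab hy
    simp only [Set.mem_ofPred_eq]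
    constructor
    · rintro ⟨h1, h2⟩
      rw [h1] at h2
      rcases le_or_gt (runInf X t ω) (-z) with hI | hI
      · exact .inr ⟨h1, (hevent ω t h1).2 ⟨(tauU_lt_tauD_iff_of_runInf_le (hX.regular ω)
          (hX.zero ω) hab hy hz h1 hI).1 h2, hI⟩⟩
      · obtain ⟨h3, h4⟩ := k1.1 ⟨h1, h2, hI⟩
        exact .inl ⟨h3, h3.symm ▸ h4⟩
    · rintro (⟨h1, h2⟩ | ⟨h1, h2⟩)
      · obtain ⟨h3, h4, -⟩ := k1.2 ⟨h1, h1 ▸ h2⟩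
        exact ⟨h3, h3.symm ▸ h4⟩
      · obtain ⟨h3, h4⟩ := (hevent ω t h1).1 h2
        exact ⟨h1, h1.symm ▸ (tauU_lt_tauD_iff_of_runInf_le (hX.regular ω)
          (hX.zero ω) hab hy hz h1 h4).2 h3⟩
  · obtain ⟨-, -, hI⟩ := (tauU_eq_iff_of_lt_runInf (hX.regular ω) (hX.zero ω) hab hy).2
      ⟨h1, h1 ▸ h2⟩
    exact ((hevent ω t h3).1 h4).2.not_gt hI

end IsRegularLevy

/-! ### Reduction to regular paths -/

omit [IsProbabilityMeasure P] in
/-- Replacing the exceptional paths by the zero path makes all paths regular. -/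
lemma IsSpectrallyNegativeLevy.exists_isRegularLevy (hX : IsSpectrallyNegativeLevy X P) :
    ∃ X' : ℝ≥0 → Ω → ℝ, IsRegularLevy X' P ∧ ∀ᵐ ω ∂P, (fun t => X' t ω) = fun t => X t ω := by
  classical
  have hgood : ∀ᵐ ω ∂P, X 0 ω = 0 ∧ IsRegularPath fun t => X t ω := by
    filter_upwards [hX.zero, hX.rightCont, hX.leftLim] with ω h1 h2 h3 using ⟨h1, h2, h3⟩
  obtain ⟨N, hN, hNm, hN0⟩ := exists_measurable_superset_of_null (ae_iff.1 hgood)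
  have hNae : ∀ᵐ ω ∂P, ω ∉ N := measure_eq_zero_iff_ae_notMem.1 hN0
  have hoff : ∀ ω ∉ N, X 0 ω = 0 ∧ IsRegularPath fun t => X t ω := fun ω hω => by
    by_contra h
    exact hω (hN h)
  set X' : ℝ≥0 → Ω → ℝ := fun t ω => if ω ∈ N then 0 else X t ω
  have hon : ∀ ω ∈ N, ∀ t, X' t ω = 0 := fun ω hω t => if_pos hω
  have hXoff : ∀ ω ∉ N, ∀ t, X' t ω = X t ω := fun ω hω t => if_neg hω
  have hX' : ∀ t, X t =ᵐ[P] X' t := fun t => hNae.mono fun ω hω => (hXoff ω hω t).symm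
  have hmeas : ∀ t, Measurable (X' t) := fun t =>
    Measurable.ite hNm measurable_const (hX.measurable t)
  have hsub : ∀ s t, X t - X s =ᵐ[P] X' t - X' s := fun s t => (hX' t).sub (hX' s)
  refine ⟨X', ⟨hmeas, fun ω => ?_, fun n t ht => ?_, fun s t => ?_, fun ω => ?_⟩,
    hNae.mono fun ω hω => funext (hXoff ω hω)⟩
  · by_cases hω : ω ∈ N
    · exact hon ω hω 0
    · rw [hXoff ω hω, (hoff ω hω).1]
  · exact (hX.indep n t ht).congr fun i => hsub _ _
  · exact ((IdentDistrib.of_ae_eq ((hmeas _).sub (hmeas _)).aemeasurable (hsub _ _).symm).trans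
      (hX.stationary s t)).trans (IdentDistrib.of_ae_eq (hX.measurable t).aemeasurable (hX' t))
  · by_cases hω : ω ∈ N
    · simp only [hon ω hω]
      exact ⟨fun t => continuousWithinAt_const, fun t _ => ⟨0, tendsto_const_nhds, le_rfl⟩⟩
    · simp only [hXoff ω hω]
      exact (hoff ω hω).2

end Formulas

end DrawdownInsurance

theorem mainTheorem5 {Ω : Type*} [MeasurableSpace Ω] (P : Measure Ω) [IsProbabilityMeasure P]
    (X : ℝ≥0 → Ω → ℝ) (hX : DrawdownInsurance.IsSpectrallyNegativeLevy X P)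
    (r a b y z : ℝ) (hr : 0 ≤ r) (hb : 0 < b) (hab : b < a) (hy : 0 ≤ y) (hz : 0 ≤ z)
    (hyz : y < a ∨ z < b) :
    DrawdownInsurance.nu X P r a b y z =
        DrawdownInsurance.discExp P r (DrawdownInsurance.passageDown X (y - a))
            {ω | DrawdownInsurance.passageDown X (y - a) ω <
              DrawdownInsurance.passageUp X (b - z) ω} *
          (if a ≤ y + z then 1 else 0)
        + DrawdownInsurance.discExp P r (DrawdownInsurance.tauU X z b)
            {ω | a ≤ max (DrawdownInsurance.supAt X (DrawdownInsurance.tauU X z b) ω) y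
                    - DrawdownInsurance.infAt X (DrawdownInsurance.tauU X z b) ω ∧
                DrawdownInsurance.infAt X (DrawdownInsurance.tauU X z b) ω ≤ -z ∧
                DrawdownInsurance.supAt X (DrawdownInsurance.tauU X z b) ω ≤ b - z} *
          ((if y + z < a then 1 else 0) /
            DrawdownInsurance.discExp P r (DrawdownInsurance.tauU X 0 b) Set.univ) ∧
    DrawdownInsurance.lam X P r a b y z =
        DrawdownInsurance.discExp P r (DrawdownInsurance.passageUp X (b - z))
            {ω | DrawdownInsurance.passageUp X (b - z) ω <
              DrawdownInsurance.passageDown X (max (y - a) (-z)) ω}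
        + DrawdownInsurance.discExp P r (DrawdownInsurance.tauU X z b)
            {ω | max (DrawdownInsurance.supAt X (DrawdownInsurance.tauU X z b) ω) y
                    - DrawdownInsurance.infAt X (DrawdownInsurance.tauU X z b) ω < a ∧
                DrawdownInsurance.infAt X (DrawdownInsurance.tauU X z b) ω ≤ -z} := by
  open DrawdownInsurance in
  obtain ⟨X', hX', hpath⟩ := hX.exists_isRegularLevy
  -- Every passage time is a functional of the path alone.
  have hD : ∀ᵐ ω ∂P, tauD X' y a ω = tauD X y a ω := hpath.mono fun ω h =>
    congrArg (fun x : ℝ≥0 → ℝ => tauD (fun t (_ : Unit) => x t) y a ()) h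
  have hU : ∀ z, ∀ᵐ ω ∂P, tauU X' z b ω = tauU X z b ω := fun z => hpath.mono fun ω h =>
    congrArg (fun x : ℝ≥0 → ℝ => tauU (fun t (_ : Unit) => x t) z b ()) h
  have hup : ∀ c, ∀ᵐ ω ∂P, passageUp X' c ω = passageUp X c ω := fun c => hpath.mono fun ω h =>
    congrArg (fun x : ℝ≥0 → ℝ => passageUp (fun t (_ : Unit) => x t) c ()) h
  have hdown : ∀ c, ∀ᵐ ω ∂P, passageDown X' c ω = passageDown X c ω := fun c =>
    hpath.mono fun ω h =>
      congrArg (fun x : ℝ≥0 → ℝ => passageDown (fun t (_ : Unit) => x t) c ()) h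
  have hsup : ∀ᵐ ω ∂P, supAt X' (tauU X' z b) ω = supAt X (tauU X z b) ω := hpath.mono fun ω h =>
    congrArg (fun x : ℝ≥0 → ℝ => supAt (fun t (_ : Unit) => x t)
      (tauU (fun t (_ : Unit) => x t) z b) ()) h
  have hinf : ∀ᵐ ω ∂P, infAt X' (tauU X' z b) ω = infAt X (tauU X z b) ω := hpath.mono fun ω h =>
    congrArg (fun x : ℝ≥0 → ℝ => infAt (fun t (_ : Unit) => x t)
      (tauU (fun t (_ : Unit) => x t) z b) ()) h
  have hna : ¬ ∀ᵐ ω ∂P, Antitone fun t => X' t ω := fun h => hX.not_antitone <| by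
    filter_upwards [h, hpath] with ω h1 h2
    rwa [h2] at h1
  have e1 : nu X P r a b y z = nu X' P r a b y z := discExp_congr_ae <| by
    filter_upwards [hD, hU z] with ω h1 h2 t
    simp only [h1, h2]
  have e2 : lam X P r a b y z = lam X' P r a b y z := discExp_congr_ae <| by
    filter_upwards [hD, hU z] with ω h1 h2 t
    simp only [h1, h2]
  have e3 : discExp P r (passageDown X (y - a))
      {ω | passageDown X (y - a) ω < passageUp X (b - z) ω} = discExp P r (passageDown X' (y - a))
      {ω | passageDown X' (y - a) ω < passageUp X' (b - z) ω} := discExp_congr_ae <| by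
    filter_upwards [hdown (y - a), hup (b - z)] with ω h1 h2 t
    simp only [h1, h2]
  have e4 : discExp P r (tauU X z b)
      {ω | a ≤ max (supAt X (tauU X z b) ω) y - infAt X (tauU X z b) ω ∧
        infAt X (tauU X z b) ω ≤ -z ∧ supAt X (tauU X z b) ω ≤ b - z} =
      discExp P r (tauU X' z b)
      {ω | a ≤ max (supAt X' (tauU X' z b) ω) y - infAt X' (tauU X' z b) ω ∧
        infAt X' (tauU X' z b) ω ≤ -z ∧ supAt X' (tauU X' z b) ω ≤ b - z} :=
    discExp_congr_ae <| by
      filter_upwards [hU z, hsup, hinf] with ω h1 h2 h3 t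
      simp only [h1, h2, h3]
  have e5 : discExp P r (tauU X 0 b) Set.univ = discExp P r (tauU X' 0 b) Set.univ :=
    discExp_congr_ae <| by
      filter_upwards [hU 0] with ω h1 t
      rw [h1]
  have e6 : discExp P r (passageUp X (b - z))
      {ω | passageUp X (b - z) ω < passageDown X (max (y - a) (-z)) ω} =
      discExp P r (passageUp X' (b - z))
      {ω | passageUp X' (b - z) ω < passageDown X' (max (y - a) (-z)) ω} :=
    discExp_congr_ae <| by
      filter_upwards [hdown (max (y - a) (-z)), hup (b - z)] with ω h1 h2 t
      simp only [h1, h2]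
  have e7 : discExp P r (tauU X z b)
      {ω | max (supAt X (tauU X z b) ω) y - infAt X (tauU X z b) ω < a ∧
        infAt X (tauU X z b) ω ≤ -z} =
      discExp P r (tauU X' z b)
      {ω | max (supAt X' (tauU X' z b) ω) y - infAt X' (tauU X' z b) ω < a ∧
        infAt X' (tauU X' z b) ω ≤ -z} :=
    discExp_congr_ae <| by
      filter_upwards [hU z, hsup, hinf] with ω h1 h2 h3 t
      simp only [h1, h2, h3]
  rw [e1, e2, e3, e4, e5, e6, e7]
  refine ⟨?_, hX'.lam_eq_add hr hab hy hz⟩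
  rcases le_or_gt a (y + z) with h | h
  · rw [if_pos h, if_neg h.not_gt, hX'.nu_eq_of_le_add hab hy hyz h]
    ring
  · rw [if_neg h.not_ge, if_pos h, ← hX'.nu_mul_of_add_lt hb hab hy hz h, mul_zero, zero_add,
      mul_one_div, mul_div_cancel_right₀ _ (hX'.discExp_tauU_pos hna hr b).ne']
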